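/- Let $\mathbb{K}$ be a field and let $\Gamma$ be a commutative monoid with neutral element $\epsilon$ that is positive, i.e. $\gamma_1\gamma_2=\epsilon$ implies $\gamma_1=\gamma_2=\epsilon$. Let $\Gamma$ act on a set $S$ effectively, in the sense that $\gamma_1x\neq\gamma_2x$ for all $x\in S$ and all $\gamma_1\ne\gamma_2$ in $\Gamma$. Let $A=\bigoplus_{\gamma\in\Gamma}A_\gamma$ be an associative unital $\Gamma$-graded $\mathbb{K}$-algebra. Let $B=\operatorname{Maps}(S,\mathbb{K})$ with the right action $b^\gamma(s)=b(\gamma s)$, and let $C=A\ltimes_\Gamma B$ be the vector space $A\otimes B$ with the multiplication $(a\otimes b)(a'\otimes b')=aa'\otimes b^{\gamma}b'$ for $a'\in A_\gamma$. For $X\subset S$ let $\chi_X\in B\subset C$ be its characteristic function, $\bar X=S\setminus X$, and $C(X)=C/C\chi_{\bar X}C$; for $a\in A$ and $y\in S$ we write $a\chi_y$ for the class of $a\otimes\chi_{\{y\}}$. For a submonoid $\Gamma'\subset\Gamma$ write $z\le_{\Gamma'}z'$ if $z'=\gamma z$ for some $\gamma\in\Gamma'$. Let $m\ge 1$ and let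 $A_1,\dots,A_m$ be graded subalgebras of $A$ such that $A=A_1\otimes\cdots\otimes A_m$, i.e. the multiplication map $a_1\otimes\cdots\otimes a_m\mapsto a_1\cdots a_m$ is a bijection $A_1\otimes\cdots\otimes A_m\to A$, and such that for all $1\le i<j\le m$ the subspace $A_{ij}=A_iA_{i+1}\cdots A_j$ is a graded subalgebra of $A$. Let $J_i$ be a homogeneous basis of $A_i$. Let $Y=\bigsqcup_{i=1}^mZ_i$ be a finite subset of $S$ that is $\Gamma$-convex, i.e. $x\in Y$ and $\gamma_1\gamma_2x\in Y$ imply $\gamma_2x\in Y$. Put $Y_j=Z_1\sqcup\cdots\sqcup Z_j$ and $e_j=\chi_{\overline{Y_j}}$. Suppose that there are submonoids $\Gamma_1,\dots,\Gamma_m$ of $\Gamma$ such that 1. $A_i\cap A_\gamma=0$ for all $\gamma\in\Gamma\setminus\Gamma_i$, $1\le i\le m$; 2. $\Gamma_jZ_i\cap Y\subset\bigsqcup_{k=i}^jZ_k$ for $1\le i\le j\le m$; 3. $\Gamma_iY_j\cap Y=Y_j$ for $1\le i<j\le m$. Then the following hold. (a) For each $1\le j\le m-1$ the multiplication map $$C(Y_{j+1})e_j\otimes_{e_jC(Y_{j+1})e_j}e_jC(Y_{j+1})\to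 C(Y_{j+1})e_jC(Y_{j+1})$$ is an isomorphism of vector spaces. (b) For each $1\le j\le m$ the elements $a_1a_2\cdots a_m\chi_y$, where $a_k\in J_k$ for $1\le k\le m$, $y\in Y_j$, and $\deg(a_ka_{k+1}\cdots a_m)y\in Y_j$ for all $1\le k\le m$, form a basis of $C(Y_j)$. (c) Suppose in addition that $\operatorname{Rad}(A_\epsilon)=0$, where $\operatorname{Rad}$ is the intersection of all maximal left ideals, and that on each set $Z_j$, $j\ge2$, there is a partial order $\le_j$ such that, for $z,z'\in Z_j$: if $z\le_{\Gamma_i}z'$ for some $i\ge j$, then $z\le_jz'$; and if $z\le_{\Gamma_i}z'$ for some $i<j$, then $z'\le_jz$. Then for every $2\le j\le m$ the ideal $C(Y_j)e_{j-1}C(Y_j)$ of $C(Y_j)$ is strong idempotent, and the ideal $C(Y)\chi_{\overline{Z_1}}C(Y)$ of $C(Y)$ is strong idempotent. Here a two-sided ideal $I$ of a ring $R$ is called strong idempotent if $\operatorname{Ext}^i_R(R/I,N)=0$ for all $i\ge1$ and all $R/I$-modules $N$. -/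

import Mathlib

open scoped TensorProduct Pointwise DirectSum

noncomputable section

namespace SkewConvex

/-! ### The skew product of a graded algebra with the algebra of functions on a set

Since all grading monoids are commutative here, the monoid `Γ` is written additively:
its neutral element is `0`, and `γ +ᵥ s` denotes the action of `γ` on `s`. -/

section SkewProduct

variable {K A Γ : Type*} [Field K] [Ring A] [Algebra K A] [AddCommMonoid Γ] [DecidableEq Γ]

/-- The algebra of all functions `S → K` carries the right action `b ^ γ = (s ↦ b (γ s))`
of `Γ`; this is the map `b ↦ b ^ γ`. -/
def shift (K : Type*) [Field K] (S : Type*) [AddAction Γ S] (γ : Γ) : (S → K) →ₗ[K] (S → K) :=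
  LinearMap.funLeft K K (fun s : S => γ +ᵥ s)

/-- The interchange map `a ↦ (b ↦ a ⊗ b ^ γ)` for `a` homogeneous of degree `γ`,
extended additively to all of `A`. -/
def interchange (𝒜 : Γ → Submodule K A) [GradedAlgebra 𝒜] (S : Type*) [AddAction Γ S] :
    A →ₗ[K] (S → K) →ₗ[K] A ⊗[K] (S → K) :=
  (DirectSum.toModule K Γ _ fun γ =>
      (LinearMap.lcomp K (A ⊗[K] (S → K)) (shift K S γ)) ∘ₗ
        (TensorProduct.mk K A (S → K)) ∘ₗ (𝒜 γ).subtype) ∘ₗ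
    (DirectSum.decomposeLinearEquiv 𝒜).toLinearMap

/-- The skew product `A ⋉ Maps(S, K)`: the vector space `A ⊗ Maps(S, K)` with the multiplication
`(a ⊗ b) (a' ⊗ b') = a a' ⊗ b ^ γ b'` for `a'` homogeneous of degree `γ`. -/
def SkewProduct (𝒜 : Γ → Submodule K A) [GradedAlgebra 𝒜] (S : Type*) [AddAction Γ S] : Type _ :=
  A ⊗[K] (S → K)

variable (𝒜 : Γ → Submodule K A) [GradedAlgebra 𝒜] (S : Type*) [AddAction Γ S]

instance : AddCommGroup (SkewProduct 𝒜 S) := inferInstanceAs (AddCommGroup (A ⊗[K] (S → K)))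

instance : Module K (SkewProduct 𝒜 S) := inferInstanceAs (Module K (A ⊗[K] (S → K)))

/-- The element `a ⊗ b` of the skew product. -/
def SkewProduct.tmul (a : A) (b : S → K) : SkewProduct 𝒜 S := a ⊗ₜ[K] b

/-- The multiplication of the skew product:
`(a ⊗ b) (a' ⊗ b')` is obtained from `b ⊗ a'` by interchanging the two factors and then
multiplying by `a` on the left and by `b'` on the right. -/
def SkewProduct.mulMap :
    A ⊗[K] (S → K) →ₗ[K] A ⊗[K] (S → K) →ₗ[K] A ⊗[K] (S → K) :=
  TensorProduct.lift <| LinearMap.mk₂ K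
    (fun (a : A) (b : S → K) => TensorProduct.lift <| LinearMap.mk₂ K
      (fun (a' : A) (b' : S → K) =>
        TensorProduct.map (LinearMap.mulLeft K a) (LinearMap.mulRight K b')
          (interchange 𝒜 S a' b))
      (by intro a₁ a₂ b'; simp)
      (by intro c a' b'; simp)
      (by intro a' b₁ b₂
          rw [show LinearMap.mulRight K (b₁ + b₂)
            = LinearMap.mulRight K b₁ + LinearMap.mulRight K b₂ by ext1 x; simp [mul_add],
            TensorProduct.map_add_right]; simp)
      (by intro c a' b'
          rw [show LinearMap.mulRight K (c • b') = c • LinearMap.mulRight K b' by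
            ext1 x; simp, TensorProduct.map_smul_right]; simp))
    (by intro a₁ a₂ b
        apply TensorProduct.ext'
        intro a' b'
        rw [LinearMap.add_apply]
        simp only [TensorProduct.lift.tmul, LinearMap.mk₂_apply]
        rw [show LinearMap.mulLeft K (a₁ + a₂)
            = LinearMap.mulLeft K a₁ + LinearMap.mulLeft K a₂ by ext1 x; simp [add_mul],
            TensorProduct.map_add_left]; simp)
    (by intro c a b
        apply TensorProduct.ext'
        intro a' b'
        rw [LinearMap.smul_apply]
        simp only [TensorProduct.lift.tmul, LinearMap.mk₂_apply]
        rw [show LinearMap.mulLeft K (c • a) = c • LinearMap.mulLeft K a by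
            ext1 x; simp, TensorProduct.map_smul_left]; simp)
    (by intro a b₁ b₂
        apply TensorProduct.ext'
        intro a' b'
        rw [LinearMap.add_apply]
        simp only [TensorProduct.lift.tmul, LinearMap.mk₂_apply, map_add])
    (by intro c a b
        apply TensorProduct.ext'
        intro a' b'
        rw [LinearMap.smul_apply]
        simp only [TensorProduct.lift.tmul, LinearMap.mk₂_apply, map_smul])

instance : Mul (SkewProduct 𝒜 S) := ⟨fun x y => SkewProduct.mulMap 𝒜 S x y⟩

instance : One (SkewProduct 𝒜 S) := ⟨SkewProduct.tmul 𝒜 S 1 1⟩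

variable {S}

theorem interchange_of_mem {γ : Γ} {a : A} (ha : a ∈ 𝒜 γ) (b : S → K) :
    interchange 𝒜 S a b = a ⊗ₜ[K] (shift K S γ b) := by
  unfold interchange
  rw [LinearMap.comp_apply]
  have : (DirectSum.decomposeLinearEquiv 𝒜).toLinearMap a
      = DirectSum.lof K Γ (fun γ => 𝒜 γ) γ ⟨a, ha⟩ := DirectSum.decompose_of_mem 𝒜 ha
  rw [this, DirectSum.toModule_lof]
  rfl

/-- The defining formula of the multiplication. -/
theorem SkewProduct.tmul_mul_tmul {γ : Γ} (a : A) (b : S → K) {a' : A} (ha' : a' ∈ 𝒜 γ)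
    (b' : S → K) :
    SkewProduct.tmul 𝒜 S a b * SkewProduct.tmul 𝒜 S a' b'
      = SkewProduct.tmul 𝒜 S (a * a') (fun s => b (γ +ᵥ s) * b' s) := by
  change TensorProduct.map (LinearMap.mulLeft K a) (LinearMap.mulRight K b')
          (interchange 𝒜 S a' b) = _
  rw [interchange_of_mem 𝒜 ha']
  rfl

theorem SkewProduct.induction {P : SkewProduct 𝒜 S → Prop} (x : SkewProduct 𝒜 S) (h0 : P 0)
    (hadd : ∀ x y, P x → P y → P (x + y))
    (h : ∀ (γ : Γ) (a : A) (_ : a ∈ 𝒜 γ) (b : S → K), P (SkewProduct.tmul 𝒜 S a b)) : P x := by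
  induction x using TensorProduct.induction_on with
  | zero => exact h0
  | add x y hx hy => exact hadd x y hx hy
  | tmul a b =>
    induction a using DirectSum.Decomposition.inductionOn 𝒜 with
    | zero => rw [TensorProduct.zero_tmul]; exact h0
    | homogeneous a => exact h _ _ a.2 b
    | add a a' ha ha' => rw [TensorProduct.add_tmul]; exact hadd _ _ ha ha'

theorem SkewProduct.mul_add' (x y z : SkewProduct 𝒜 S) : x * (y + z) = x * y + x * z :=
  map_add (SkewProduct.mulMap 𝒜 S x) y z

theorem SkewProduct.add_mul' (x y z : SkewProduct 𝒜 S) : (x + y) * z = x * z + y * z :=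
  LinearMap.map_add₂ (SkewProduct.mulMap 𝒜 S) x y z

theorem SkewProduct.mul_zero' (x : SkewProduct 𝒜 S) : x * 0 = 0 :=
  map_zero (SkewProduct.mulMap 𝒜 S x)

theorem SkewProduct.zero_mul' (x : SkewProduct 𝒜 S) : 0 * x = 0 :=
  LinearMap.map_zero₂ (SkewProduct.mulMap 𝒜 S) x

theorem SkewProduct.mul_assoc' (x y z : SkewProduct 𝒜 S) : x * y * z = x * (y * z) := by
  induction x using SkewProduct.induction 𝒜 with
  | h0 => simp only [SkewProduct.zero_mul']
  | hadd x x' hx hx' => simp only [SkewProduct.add_mul', hx, hx']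
  | h γ₁ a₁ h₁ b₁ =>
  induction y using SkewProduct.induction 𝒜 with
  | h0 => simp only [SkewProduct.zero_mul', SkewProduct.mul_zero']
  | hadd x x' hx hx' => simp only [SkewProduct.add_mul', SkewProduct.mul_add', hx, hx']
  | h γ₂ a₂ h₂ b₂ =>
  induction z using SkewProduct.induction 𝒜 with
  | h0 => simp only [SkewProduct.mul_zero']
  | hadd x x' hx hx' => simp only [SkewProduct.mul_add', hx, hx']
  | h γ₃ a₃ h₃ b₃ =>
  rw [SkewProduct.tmul_mul_tmul 𝒜 a₁ b₁ h₂, SkewProduct.tmul_mul_tmul 𝒜 _ _ h₃,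
    SkewProduct.tmul_mul_tmul 𝒜 a₂ b₂ h₃,
    SkewProduct.tmul_mul_tmul 𝒜 _ _ (SetLike.mul_mem_graded h₂ h₃), mul_assoc]
  congr 1
  funext s
  rw [add_vadd, mul_assoc]

theorem SkewProduct.one_mul' (x : SkewProduct 𝒜 S) : 1 * x = x := by
  induction x using SkewProduct.induction 𝒜 with
  | h0 => simp only [SkewProduct.mul_zero']
  | hadd x x' hx hx' => simp only [SkewProduct.mul_add', hx, hx']
  | h γ a h b =>
    change SkewProduct.tmul 𝒜 S 1 1 * _ = _
    rw [SkewProduct.tmul_mul_tmul 𝒜 _ _ h]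
    simp

theorem SkewProduct.mul_one' (x : SkewProduct 𝒜 S) : x * 1 = x := by
  induction x using SkewProduct.induction 𝒜 with
  | h0 => simp only [SkewProduct.zero_mul']
  | hadd x x' hx hx' => simp only [SkewProduct.add_mul', hx, hx']
  | h γ a h b =>
    change _ * SkewProduct.tmul 𝒜 S 1 1 = _
    rw [SkewProduct.tmul_mul_tmul 𝒜 _ _ (SetLike.one_mem_graded 𝒜)]
    simp

variable (S)

instance : Ring (SkewProduct 𝒜 S) where
  __ := (inferInstance : AddCommGroup (SkewProduct 𝒜 S))
  left_distrib := SkewProduct.mul_add' 𝒜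
  right_distrib := SkewProduct.add_mul' 𝒜
  zero_mul := SkewProduct.zero_mul' 𝒜
  mul_zero := SkewProduct.mul_zero' 𝒜
  mul_assoc := SkewProduct.mul_assoc' 𝒜
  one_mul := SkewProduct.one_mul' 𝒜
  mul_one := SkewProduct.mul_one' 𝒜

instance : Algebra K (SkewProduct 𝒜 S) :=
  Algebra.ofModule
    (fun c x y => LinearMap.map_smul₂ (SkewProduct.mulMap 𝒜 S) c x y)
    (fun c x y => LinearMap.map_smul (SkewProduct.mulMap 𝒜 S x) c y)

variable {S}

/-- The element `a χ_X` of the skew product, where `χ_X` is the characteristic function of `X`. -/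
def mulChi (a : A) (X : Set S) : SkewProduct 𝒜 S :=
  SkewProduct.tmul 𝒜 S a (X.indicator 1)

/-- The algebra `C(X) = C / C χ_{Xᶜ} C`, where `C` is the skew product of `A` and `Maps(S, K)`. -/
abbrev CAlg (X : Set S) : Type _ :=
  (TwoSidedIdeal.span {mulChi 𝒜 1 Xᶜ}).ringCon.Quotient

/-- The class of `a χ_V` in `C(X)`. -/
def CAlg.chi (X : Set S) (a : A) (V : Set S) : CAlg 𝒜 X :=
  ((mulChi 𝒜 a V : SkewProduct 𝒜 S) : (TwoSidedIdeal.span {mulChi 𝒜 1 Xᶜ}).ringCon.Quotient)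

/-- The class in `C(X)` of the idempotent `χ_V`. -/
def CAlg.idem (X V : Set S) : CAlg 𝒜 X := CAlg.chi 𝒜 X 1 V

end SkewProduct

/-! ### The multiplication map `R e ⊗_{e R e} e R → R` -/

section Balanced

variable (K M N : Type*) {E V : Type*} [Field K] [AddCommGroup M] [Module K M]
  [AddCommGroup N] [Module K N] [AddCommGroup V] [Module K V]

/-- The tensor product over `E` of a space `M` with a right action `ρ` of `E` and a space `N` with
a left action `ℓ` of `E`: the quotient of `M ⊗ N` by the relations `m r ⊗ n = m ⊗ r n`. -/
abbrev BalancedTensor (ρ : E → M → M) (ℓ : E → N → N) : Type _ :=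
  (M ⊗[K] N) ⧸ Submodule.span K
    {t : M ⊗[K] N | ∃ (m : M) (r : E) (n : N), t = ρ r m ⊗ₜ[K] n - m ⊗ₜ[K] ℓ r n}

variable {K M N}

/-- The linear map `m ⊗ n ↦ β m n` out of a balanced tensor product. -/
def BalancedTensor.lift (ρ : E → M → M) (ℓ : E → N → N) (β : M →ₗ[K] N →ₗ[K] V)
    (h : ∀ r m n, β (ρ r m) n = β m (ℓ r n)) : BalancedTensor K M N ρ ℓ →ₗ[K] V :=
  Submodule.liftQ _ (TensorProduct.lift β) (by
    rw [Submodule.span_le]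
    rintro t ⟨m, r, n, rfl⟩
    simp [h])

end Balanced

section Corner

variable (K : Type*) {R : Type*} [Field K] [Ring R] [Algebra K R] (e : R)

/-- The left ideal `R e`, as a vector space. -/
def leftPart : Submodule K R := LinearMap.range (LinearMap.mulRight K e)

/-- The right ideal `e R`, as a vector space. -/
def rightPart : Submodule K R := LinearMap.range (LinearMap.mulLeft K e)

/-- The corner `e R e`, as a vector space. -/
def corner : Submodule K R := LinearMap.range (LinearMap.mulLeft K e ∘ₗ LinearMap.mulRight K e)

theorem mul_mem_leftPart (x : R) {r : R} (hr : r ∈ corner K e) : x * r ∈ leftPart K e := by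
  obtain ⟨r', rfl⟩ := hr
  exact ⟨x * (e * r'), by simp [mul_assoc]⟩

theorem mul_mem_rightPart (y : R) {r : R} (hr : r ∈ corner K e) : r * y ∈ rightPart K e := by
  obtain ⟨r', rfl⟩ := hr
  exact ⟨r' * e * y, by simp [mul_assoc]⟩

/-- The right action of `e R e` on `R e`. -/
def cornerRight (r : corner K e) (x : leftPart K e) : leftPart K e :=
  ⟨x.1 * r.1, mul_mem_leftPart K e x.1 r.2⟩

/-- The left action of `e R e` on `e R`. -/
def cornerLeft (r : corner K e) (y : rightPart K e) : rightPart K e :=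
  ⟨r.1 * y.1, mul_mem_rightPart K e y.1 r.2⟩

/-- The tensor product `R e ⊗_{e R e} e R`. -/
abbrev CornerTensor : Type _ :=
  BalancedTensor K (leftPart K e) (rightPart K e) (cornerRight K e) (cornerLeft K e)

/-- The map `R e ⊗_{e R e} e R → R`, `x ⊗ y ↦ x y`. -/
def cornerMul : CornerTensor K e →ₗ[K] R :=
  BalancedTensor.lift (cornerRight K e) (cornerLeft K e)
    ((LinearMap.mul K R).domRestrict₁₂ (leftPart K e) (rightPart K e))
    (fun _ _ _ => mul_assoc _ _ _)

end Corner

/-! ### Strong idempotent ideals -/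

open CategoryTheory in
/-- A two-sided ideal `I` of a ring `R` is strong idempotent if `Ext_R^i(R/I, N) = 0` for all
`i ≥ 1` and all `R/I`-modules `N`, that is, all `R`-modules `N` with `I N = 0`. -/
def IsStrongIdempotent.{u} {R : Type u} [Ring R] (I : TwoSidedIdeal R) : Prop :=
  ∀ N : ModuleCat.{u} R, (∀ x ∈ I, ∀ n : N, x • n = 0) →
    ∀ i : ℕ, 1 ≤ i → Subsingleton (Abelian.Ext (ModuleCat.of R (R ⧸ I.asIdeal)) N i)

/-! ### The hypotheses on the action and on the decomposition of the algebra -/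

/-- The submonoid `P` induces the relation `z ≤ z'` if and only if `z' = γ z` for some `γ ∈ P`. -/
def leBy {Γ S : Type*} [AddCommMonoid Γ] [AddAction Γ S] (P : AddSubmonoid Γ) (z z' : S) : Prop :=
  ∃ γ ∈ P, z' = γ +ᵥ z

/-- `Y` is `Γ`-convex: it contains all points that lie between two points of `Y`. -/
def IsGammaConvex (Γ : Type*) {S : Type*} [AddCommMonoid Γ] [AddAction Γ S] (Y : Set S) : Prop :=
  ∀ (γ₁ γ₂ : Γ) (x : S), x ∈ Y → (γ₁ + γ₂) +ᵥ x ∈ Y → γ₂ +ᵥ x ∈ Y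

section Decomposition

variable {K A Γ : Type*} [Field K] [Ring A] [Algebra K A] [AddCommMonoid Γ] [DecidableEq Γ]

/-- A subspace `M` of `A` is a graded subalgebra. -/
def IsGradedSubalgebra (𝒜 : Γ → Submodule K A) [GradedAlgebra 𝒜] (M : Submodule K A) : Prop :=
  (1 ∈ M ∧ ∀ x ∈ M, ∀ y ∈ M, x * y ∈ M) ∧
    ∀ x ∈ M, ∀ γ : Γ, (DirectSum.decompose 𝒜 x γ : A) ∈ M

/-- The multiplication map `A_1 ⊗ ⋯ ⊗ A_m → A`, `a_1 ⊗ ⋯ ⊗ a_m ↦ a_1 ⋯ a_m`. -/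
def prodMap {m : ℕ} (As : Fin m → Submodule K A) : (⨂[K] i, As i) →ₗ[K] A :=
  PiTensorProduct.lift
    ((MultilinearMap.mkPiAlgebraFin K m A).compLinearMap fun i => (As i).subtype)

/-- The subspace `A_{ij} = A_i A_{i+1} ⋯ A_j` of `A`, spanned by the products
`a_i a_{i+1} ⋯ a_j` with `a_k ∈ A_k`. -/
def interval {m : ℕ} (As : Fin m → Submodule K A) (i j : Fin m) : Submodule K A :=
  (((List.finRange m).filter fun k => i ≤ k ∧ k ≤ j).map As).prod

end Decomposition

/-- The union `Y_j` of the sets `Z_k` with `k ≤ j`. -/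
def initialUnion {m : ℕ} {S : Type*} (Z : Fin m → Set S) (j : Fin m) : Set S :=
  ⋃ k ≤ j, Z k

section Basis

variable {K A Γ S : Type*} [Field K] [Ring A] [Algebra K A] [AddCommMonoid Γ] [DecidableEq Γ]
  [AddAction Γ S]

/-- The index set of the basis of `C(X)`: the families `(a_1, …, a_m, y)`, where `a_k` is (the index
of) a basis element of `A_k` of degree `d_k`, such that `y` and all the points
`deg(a_k a_{k+1} ⋯ a_m) y` with `1 ≤ k ≤ m` belong to `X`. -/
def BasisIndex {m : ℕ} {ι : Fin m → Type*} (d : ∀ i, ι i → Γ) (X : Set S) : Type _ :=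
  {p : (∀ k, ι k) × S // p.2 ∈ X ∧
    ∀ k : Fin m, (∑ l ∈ Finset.Ici k, d l (p.1 l)) +ᵥ p.2 ∈ X}

/-- The element `a_1 a_2 ⋯ a_m χ_y` of `C(X)`. -/
def basisElement (𝒜 : Γ → Submodule K A) [GradedAlgebra 𝒜] {m : ℕ} {ι : Fin m → Type*}
    {As : Fin m → Submodule K A} (J : ∀ i, Module.Basis (ι i) K (As i)) (d : ∀ i, ι i → Γ)
    (X : Set S) (p : BasisIndex d X) : CAlg 𝒜 X :=
  CAlg.chi 𝒜 X (List.ofFn fun k => (J k (p.1.1 k) : A)).prod {p.1.2}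

end Basis

end SkewConvex

end

/-! Strata are numbered from 0, and `lowerUnion Z p` is the union of the first `p` of them. A
product of basis elements `a_1 ⋯ a_m χ_y` is viewed as a path in `S`: it starts at `y` and passes
through the points obtained by applying the degrees of `a_m, a_{m-1}, …` one after the other. If the
path leaves `X`, the product vanishes in `C(X)`, so the products whose path stays in `X` span.

They are independent for `X = lowerUnion Z q`, because reading off a coordinate of `A` and
evaluating at `y` gives a functional on the skew product that kills the ideal of `χ_{Xᶜ}`. This
rests on `mul_mem_exitSpan`: a product `c c'` that is outside `X` at its intermediate point is a
combination of basis products whose paths leave `X`. Convexity settles the case where that point is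
outside `Y`; the closure of `A_p ⋯ A_m` under multiplication carries the induction down the strata.

Now let `R = C(lowerUnion Z (p + 1))`, and let `e` be the sum of the `χ_z` for `z` in stratum `p`.
The conditions on the `Γ_i` force a path in `lowerUnion Z (p + 1)` that starts or ends in stratum
`p` to be in it also between the factors of index below `p` and those from `p` on. Cutting there
writes `R e R` as the span of independent products `l r` with a common point `z`, where the low
products `l` and the high products `r` each span a multiplicatively closed family
(`isFactorization`). This triangular structure yields the other claims.

For the tensor product, moving `r` to the right and `l` to the left across the tensor sign shows
that the `l ⊗ r` span `R e ⊗ e R`; their images are independent, so multiplication is injective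
(`injective_cornerMul`).

For strong idempotence, `R e R` and every `R χ_z` are free over their subspaces spanned by high
products, with the `l` as basis (`IsFreeOver`). Modules of this kind are covered by direct sums of
the `R χ_z` with kernels of the same kind. So if `N` is killed by all `χ_z` and has no higher
extensions from `R`, dimension shifting gives `Ext^i(R e R, N) = 0` for all `i ≥ 0`, and then the
higher extensions from `R / R e R` to `N` vanish (`subsingleton_ext_quotient`). Removing the strata
one at a time, starting from the projective module `C(lowerUnion Z n)`, reaches `C(lowerUnion Z q)`.
-/

noncomputable section

namespace SkewConvex

/-! ### Vanishing of Ext: dimension shifting, retracts, direct sums -/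

section ExtVanishing

open CategoryTheory Abelian

universe u

variable {Λ : Type u} [Ring Λ] {N : ModuleCat.{u} Λ}

theorem subsingleton_ext_zero {W : Type u} [AddCommGroup W] [Module Λ W]
    (h : ∀ φ : W →ₗ[Λ] N, φ = 0) : Subsingleton (Ext (ModuleCat.of Λ W) N 0) := by
  refine ⟨fun a b => ?_⟩
  obtain ⟨f, rfl⟩ := Ext.addEquiv₀.symm.surjective a
  obtain ⟨g, rfl⟩ := Ext.addEquiv₀.symm.surjective b
  congr 1
  ext1
  rw [h f.hom, h g.hom]

theorem eq_zero_of_subsingleton_ext_zero {W : Type u} [AddCommGroup W] [Module Λ W]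
    (h : Subsingleton (Ext (ModuleCat.of Λ W) N 0)) (φ : W →ₗ[Λ] N) : φ = 0 := by
  have h₁ : Ext.mk₀ (ModuleCat.ofHom φ) = 0 := Subsingleton.elim _ _
  rw [Ext.mk₀_eq_zero_iff] at h₁
  simpa using congrArg ModuleCat.Hom.hom h₁

theorem subsingleton_ext_succ_of_surjective {P W : Type u} [AddCommGroup P] [Module Λ P]
    [AddCommGroup W] [Module Λ W] (g : P →ₗ[Λ] W) (hg : Function.Surjective g) (i : ℕ)
    (hK : Subsingleton (Ext (ModuleCat.of Λ (LinearMap.ker g)) N i))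
    (hP : Subsingleton (Ext (ModuleCat.of Λ P) N (i + 1))) :
    Subsingleton (Ext (ModuleCat.of Λ W) N (i + 1)) := by
  refine subsingleton_of_forall_eq 0 fun x => ?_
  have hS := LinearMap.shortExact_shortComplexKer hg
  obtain ⟨y, rfl⟩ := Ext.contravariant_sequence_exact₃ hS N x
    (@Subsingleton.elim _ hP _ _) (n₀ := i) (by omega)
  rw [@Subsingleton.elim _ hK y 0, Ext.comp_zero]

theorem subsingleton_ext_of_retract {P W : Type u} [AddCommGroup P] [Module Λ P]
    [AddCommGroup W] [Module Λ W] (f : W →ₗ[Λ] P) (g : P →ₗ[Λ] W) (hfg : ∀ w, g (f w) = w) (i : ℕ)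
    (hP : Subsingleton (Ext (ModuleCat.of Λ P) N i)) :
    Subsingleton (Ext (ModuleCat.of Λ W) N i) := by
  refine subsingleton_of_forall_eq 0 fun x => ?_
  have h : ModuleCat.ofHom f ≫ ModuleCat.ofHom g = 𝟙 (ModuleCat.of Λ W) := by
    ext w
    exact hfg w
  rw [← Ext.mk₀_id_comp x, ← h, ← Ext.mk₀_comp_mk₀_assoc,
    @Subsingleton.elim _ hP ((Ext.mk₀ (ModuleCat.ofHom g)).comp x _) 0, Ext.comp_zero]

theorem exists_shortExact_injective (N : ModuleCat.{u} Λ) :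
    ∃ S : ShortComplex (ModuleCat.{u} Λ), S.ShortExact ∧ Injective S.X₂ ∧ S.X₁ = N :=
  ⟨ShortComplex.mk (Injective.ι N) (Limits.cokernel.π (Injective.ι N)) (Limits.cokernel.condition _),
    { exact := ShortComplex.exact_cokernel _
      mono_f := (inferInstance : Mono (Injective.ι N))
      epi_g := (inferInstance : Epi (Limits.cokernel.π (Injective.ι N))) },
    (inferInstance : Injective (Injective.under N)), rfl⟩

/-- Dimension shifting in the second argument along `0 → N → I → N' → 0` with `I` injective, which
is why `N` is quantified inside the induction. In degree one, vanishing means that maps to `N'` lift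
to `I`, and lifts on the summands glue to a lift on the direct sum. -/
theorem subsingleton_ext_directSum {X : Type u} [DecidableEq X] (T : X → Type u)
    [∀ x, AddCommGroup (T x)] [∀ x, Module Λ (T x)] (i : ℕ) :
    ∀ N : ModuleCat.{u} Λ, (∀ x, Subsingleton (Ext (ModuleCat.of Λ (T x)) N (i + 1))) →
      Subsingleton (Ext (ModuleCat.of Λ (⨁ x, T x)) N (i + 1)) := by
  induction i with
  | zero =>
    intro N h
    obtain ⟨S, hS, hI, rfl⟩ := exists_shortExact_injective N
    refine subsingleton_of_forall_eq 0 fun x => ?_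
    obtain ⟨x₃, rfl⟩ := Ext.covariant_sequence_exact₁ _ hS x
      (Ext.eq_zero_of_injective _) (n₀ := 0) rfl
    obtain ⟨φ, rfl⟩ := (Ext.mk₀_bijective _ _).2 x₃
    -- The obstruction to lifting the component at `t` lies in `Ext^1(T t, N)`, which is zero.
    have h₂ : ∀ t, ∃ ψ : T t →ₗ[Λ] S.X₂, S.g.hom ∘ₗ ψ = φ.hom ∘ₗ DirectSum.lof Λ X T t := by
      intro t
      obtain ⟨y, hy⟩ := Ext.covariant_sequence_exact₃ _ hS
        (Ext.mk₀ (ModuleCat.ofHom (φ.hom ∘ₗ DirectSum.lof Λ X T t))) (n₁ := 1) rfl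
        (@Subsingleton.elim _ (h t) _ _)
      obtain ⟨ψ, rfl⟩ := (Ext.mk₀_bijective _ _).2 y
      rw [Ext.mk₀_comp_mk₀] at hy
      exact ⟨ψ.hom, congrArg ModuleCat.Hom.hom ((Ext.mk₀_bijective _ _).1 hy)⟩
    choose ψ hψ using h₂
    have h₃ : φ = ModuleCat.ofHom (DirectSum.toModule Λ X S.X₂ ψ) ≫ S.g := by
      ext1
      refine DirectSum.linearMap_ext Λ fun t => ?_
      rw [← hψ t]
      ext y
      simp [DirectSum.toModule_lof]
    rw [h₃, ← Ext.mk₀_comp_mk₀, Ext.comp_assoc_of_second_deg_zero, hS.comp_extClass, Ext.comp_zero]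
  | succ i ih =>
    intro N h
    obtain ⟨S, hS, hI, rfl⟩ := exists_shortExact_injective N
    refine subsingleton_of_forall_eq 0 fun x => ?_
    obtain ⟨x₃, rfl⟩ := Ext.covariant_sequence_exact₁ _ hS x
      (Ext.eq_zero_of_injective _) (n₀ := i + 1) rfl
    have h₂ : Subsingleton (Ext (ModuleCat.of Λ (⨁ x, T x)) S.X₃ (i + 1)) := by
      refine ih _ fun t => subsingleton_of_forall_eq 0 fun y => ?_
      obtain ⟨z, rfl⟩ := Ext.covariant_sequence_exact₃ _ hS y (n₁ := i + 1 + 1) rfl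
        (@Subsingleton.elim _ (h t) _ _)
      rw [Ext.eq_zero_of_injective z, Ext.zero_comp]
    rw [@Subsingleton.elim _ h₂ x₃ 0, Ext.zero_comp]

end ExtVanishing

/-! ### Modules that are free over a family of additive subgroups -/

section FreeOver

open CategoryTheory Abelian

universe u v w

variable {Λ : Type u} [Ring Λ] {ζ : Type v} {β : Type w}
  (T : ζ → Type u) [∀ z, AddCommGroup (T z)] [∀ z, Module Λ (T z)] (t : ∀ z, T z)
  (D : ∀ z, ζ → AddSubgroup (T z)) (l : β → Λ) (s : β → ζ)

/-- The module `W` is free over the family `M` of additive subgroups, with basis `l`: every element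
of `W` is a unique combination `∑ l b • p b` with `p b ∈ M (s b)`. Moreover the elements of `M z`
correspond to morphisms `T z → W` that are compatible with the families of subgroups. -/
structure IsFreeOver {W : Type u} [AddCommGroup W] [Module Λ W] (M : ζ → AddSubgroup W) :
    Prop where
  exists_hom : ∀ z, ∀ x ∈ M z, ∃ h : T z →ₗ[Λ] W, h (t z) = x ∧ ∀ z', ∀ y ∈ D z z', h y ∈ M z'
  exists_sum : ∀ x : W, ∃ p : β →₀ W, (∀ b, p b ∈ M (s b)) ∧ p.sum (fun b y => l b • y) = x
  eq_zero : ∀ p : β →₀ W, (∀ b, p b ∈ M (s b)) → p.sum (fun b y => l b • y) = 0 → p = 0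

variable {T t D l s}

theorem sum_smul_mapRange {W W' : Type u} [AddCommGroup W] [Module Λ W] [AddCommGroup W']
    [Module Λ W'] (f : W →ₗ[Λ] W') (p : β →₀ W) :
    (p.mapRange f f.map_zero).sum (fun b y => l b • y) = f (p.sum fun b y => l b • y) := by
  rw [Finsupp.sum_mapRange_index (by simp), map_finsuppSum]
  simp

/-- The family of additive subgroups of a direct sum given by the elements all of whose components
belong to the given subgroups. -/
def directSumFamily {X : Type u} (z : X → ζ) (D : ∀ z, ζ → AddSubgroup (T z)) (z' : ζ) :
    AddSubgroup (⨁ x, T (z x)) where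
  carrier := {p | ∀ x, p x ∈ D (z x) z'}
  zero_mem' x := (D (z x) z').zero_mem
  add_mem' ha hb x := (D (z x) z').add_mem (ha x) (hb x)
  neg_mem' ha x := (D (z x) z').neg_mem (ha x)

theorem isFreeOver_directSum (hT : ∀ z, IsFreeOver T t D l s (D z)) {X : Type u} [DecidableEq X]
    (z : X → ζ) : IsFreeOver T t D l s (directSumFamily z D) := by
  classical
  have hlof : ∀ (z' : ζ) (x : X) (y : T (z x)), y ∈ D (z x) z' →
      DirectSum.lof Λ X (fun x => T (z x)) x y ∈ directSumFamily z D z' := by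
    intro z' x y hy x'
    rw [DirectSum.lof_eq_of]
    by_cases hx : x = x'
    · subst hx
      rwa [DirectSum.of_eq_same]
    · rw [DirectSum.of_eq_of_ne _ _ _ (Ne.symm hx)]
      exact zero_mem _
  refine ⟨fun z' p hp => ?_, fun p => ?_, fun p hp h => ?_⟩
  · choose h h₁ h₂ using fun x => (hT (z x)).exists_hom z' (p x) (hp x)
    refine ⟨∑ x ∈ DFinsupp.support p, DirectSum.lof Λ X (fun x => T (z x)) x ∘ₗ h x, ?_, ?_⟩
    · simp only [LinearMap.sum_apply, LinearMap.comp_apply, h₁, DirectSum.lof_eq_of]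
      exact DirectSum.sum_support_of p
    · intro z'' y hy
      rw [LinearMap.sum_apply]
      exact sum_mem fun x _ => hlof _ _ _ (h₂ x _ _ hy)
  · induction p using DirectSum.induction_on with
    | zero => exact ⟨0, fun b => zero_mem _, by simp⟩
    | of x y =>
      obtain ⟨q, hq, rfl⟩ := (hT (z x)).exists_sum y
      refine ⟨q.mapRange (DirectSum.lof Λ X (fun x => T (z x)) x) (map_zero _), fun b => ?_, ?_⟩
      · rw [Finsupp.mapRange_apply]
        exact hlof _ _ _ (hq b)
      · rw [sum_smul_mapRange, DirectSum.lof_eq_of]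
    | add p p' hp hp' =>
      obtain ⟨q, hq, rfl⟩ := hp
      obtain ⟨q', hq', rfl⟩ := hp'
      refine ⟨q + q', fun b => add_mem (hq b) (hq' b), ?_⟩
      rw [Finsupp.sum_add_index' (by simp) (by simp)]
  · ext b x
    have h' := (hT (z x)).eq_zero
      (p.mapRange (DirectSum.component Λ X (fun x => T (z x)) x) (map_zero _))
      (fun b => hp b x) (by rw [sum_smul_mapRange, h, map_zero])
    exact DFunLike.congr_fun h' b

/-- Uniqueness of coefficients in `W` forces the coefficients of an element of the kernel to lie in
the kernel. A morphism out of `T z` lands in the kernel as soon as the generator `t z` does. -/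
theorem isFreeOver_ker (hgen : ∀ z, Submodule.span Λ {t z} = ⊤) {P W : Type u}
    [AddCommGroup P] [Module Λ P] [AddCommGroup W] [Module Λ W] {M' : ζ → AddSubgroup P}
    {M : ζ → AddSubgroup W} (hP : IsFreeOver T t D l s M') (hW : IsFreeOver T t D l s M)
    (g : P →ₗ[Λ] W) (hg : ∀ z, ∀ y ∈ M' z, g y ∈ M z) :
    IsFreeOver T t D l s fun z => (M' z).comap (LinearMap.ker g).subtype.toAddMonoidHom := by
  refine ⟨fun z x hx => ?_, fun x => ?_, fun p hp h => ?_⟩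
  · obtain ⟨h, h₁, h₂⟩ := hP.exists_hom z x hx
    have h₃ : g ∘ₗ h = 0 := by
      refine LinearMap.ext_on (hgen z) ?_
      rintro _ rfl
      simp [h₁]
    exact ⟨h.codRestrict _ fun y => LinearMap.congr_fun h₃ y, Subtype.ext h₁, fun z' y hy =>
      h₂ z' y hy⟩
  · obtain ⟨p, hp, hpx⟩ := hP.exists_sum x
    have h₁ : p.mapRange g g.map_zero = 0 := by
      refine hW.eq_zero _ (fun b => hg _ _ (hp b)) ?_
      rw [sum_smul_mapRange, hpx]
      exact x.2
    have h₂ : ∀ b, p b ∈ LinearMap.ker g := fun b => DFunLike.congr_fun h₁ b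
    let q : β →₀ LinearMap.ker g := Finsupp.onFinset p.support (fun b => ⟨p b, h₂ b⟩) (by
      intro b hb
      rw [Finsupp.mem_support_iff]
      exact fun h => hb (Subtype.ext h))
    have hq : q.mapRange (LinearMap.ker g).subtype (map_zero _) = p := by
      ext b
      rfl
    refine ⟨q, hp, Subtype.ext ?_⟩
    rw [← hpx, ← hq, sum_smul_mapRange]
    rfl
  · have h₁ := hP.eq_zero (p.mapRange (LinearMap.ker g).subtype (map_zero _)) hp
      (by rw [sum_smul_mapRange, h, map_zero])
    ext b
    exact DFunLike.congr_fun h₁ b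

/-- The elements of the subgroups generate `W`, so `W` is a quotient of a direct sum of modules `T
z`, and the kernel is again free over its family. Hence degree `i + 1` for `W` follows from degree
`i` for the kernel. -/
theorem subsingleton_ext_of_isFreeOver (hgen : ∀ z, Submodule.span Λ {t z} = ⊤)
    (hT : ∀ z, IsFreeOver T t D l s (D z)) {N : ModuleCat.{u} Λ}
    (hN : ∀ z i, Subsingleton (Ext (ModuleCat.of Λ (T z)) N i)) (i : ℕ) :
    ∀ {W : Type u} [AddCommGroup W] [Module Λ W] {M : ζ → AddSubgroup W},
      IsFreeOver T t D l s M → Subsingleton (Ext (ModuleCat.of Λ W) N i) := by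
  classical
  induction i with
  | zero =>
    intro W _ _ M hW
    refine subsingleton_ext_zero fun φ => LinearMap.ext fun x => ?_
    obtain ⟨p, hp, rfl⟩ := hW.exists_sum x
    rw [map_finsuppSum]
    refine Finset.sum_eq_zero fun b _ => ?_
    obtain ⟨h, h₁, -⟩ := hW.exists_hom _ _ (hp b)
    -- The coefficient `p b` is the image of `t (s b)` under a map `T (s b) → W`, and every map from
    -- `T (s b)` to `N` is zero.
    change φ (l b • p b) = 0
    rw [map_smul, ← h₁, ← LinearMap.comp_apply,
      eq_zero_of_subsingleton_ext_zero (hN (s b) 0) (φ ∘ₗ h), LinearMap.zero_apply, smul_zero]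
  | succ i ih =>
    intro W _ _ M hW
    -- One summand for each element of the subgroups, mapping its generator to that element.
    let X := {x : W // ∃ z, x ∈ M z}
    choose z hz using fun x : X => x.2
    choose h h₁ h₂ using fun x : X => hW.exists_hom (z x) x.1 (hz x)
    let g : (⨁ x, T (z x)) →ₗ[Λ] W := DirectSum.toModule Λ X W h
    have hg : Function.Surjective g := by
      intro x
      obtain ⟨p, hp, rfl⟩ := hW.exists_sum x
      rw [← LinearMap.mem_range]
      refine sum_mem fun b _ => Submodule.smul_mem _ _
        ⟨DirectSum.lof Λ X _ ⟨p b, s b, hp b⟩ (t _), ?_⟩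
      rw [DirectSum.toModule_lof, h₁]
    have hgM : ∀ z', ∀ y ∈ directSumFamily z D z', g y ∈ M z' := by
      intro z' y hy
      rw [← DirectSum.sum_support_of y, map_sum]
      refine sum_mem fun x _ => ?_
      rw [← DirectSum.lof_eq_of Λ, DirectSum.toModule_lof]
      exact h₂ _ _ _ (hy x)
    exact subsingleton_ext_succ_of_surjective g hg i
      (ih (isFreeOver_ker hgen (isFreeOver_directSum hT z) hW g hgM))
      (subsingleton_ext_directSum _ i N fun x => hN (z x) (i + 1))

end FreeOver

/-! ### Triangular factorizations and the multiplication map `R e ⊗ e R → R` -/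

section Factorization

universe u

/-- A factorization of the part of the algebra `R` supported at the orthogonal idempotents `χ z`:
the products `l b * r c` with matching middle idempotents are linearly independent, they span all
elements with source or target among the `χ z`, and the spans of the `l b` and of the `r c` are
closed under multiplication. -/
structure IsFactorization (K : Type*) {R Z β ρ : Type*} [Field K] [Ring R] [Algebra K R]
    (χ : Z → R) (l : β → R) (s : β → Z) (r : ρ → R) (τ : ρ → Z) : Prop where
  idem : ∀ z, χ z * χ z = χ z
  orth : ∀ z z', z ≠ z' → χ z * χ z' = 0
  l_mul : ∀ b, l b * χ (s b) = l b
  mul_r : ∀ c, χ (τ c) * r c = r c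
  linIndep : LinearIndepOn K (fun x : β × ρ => l x.1 * r x.2) {x | s x.1 = τ x.2}
  mul_chi_mem : ∀ x z, x * χ z ∈
    Submodule.span K {y | ∃ b c, s b = τ c ∧ r c * χ z = r c ∧ y = l b * r c}
  chi_mul_mem : ∀ x z, χ z * x ∈
    Submodule.span K {y | ∃ b c, s b = τ c ∧ χ z * l b = l b ∧ y = l b * r c}
  r_mul_r : ∀ c c', r c * r c' ∈ Submodule.span K (r '' {c'' | τ c'' = τ c})
  l_mul_l : ∀ b b', l b * l b' ∈ Submodule.span K (l '' {b'' | s b'' = s b'})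

namespace IsFactorization

variable {K R Z β ρ : Type*} [Field K] [Ring R] [Algebra K R]
  {χ : Z → R} {l : β → R} {s : β → Z} {r : ρ → R} {τ : ρ → Z}

section Idempotent

variable [Fintype Z] {e : R}

theorem mul_sum (h : IsFactorization K χ l s r τ) (he : e = ∑ z, χ z) (z : Z) :
    χ z * e = χ z := by
  rw [he, Finset.mul_sum, Finset.sum_eq_single z (fun z' _ hz' => h.orth _ _ hz'.symm) (by simp),
    h.idem]

theorem sum_mul (h : IsFactorization K χ l s r τ) (he : e = ∑ z, χ z) (z : Z) :
    e * χ z = χ z := by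
  rw [he, Finset.sum_mul, Finset.sum_eq_single z (fun z' _ hz' => h.orth _ _ hz') (by simp),
    h.idem]

theorem sum_mul_sum (h : IsFactorization K χ l s r τ) (he : e = ∑ z, χ z) : e * e = e := by
  nth_rw 2 [he]
  rw [Finset.mul_sum, Finset.sum_congr rfl fun z _ => h.sum_mul he z, he]

theorem l_mul_sum (h : IsFactorization K χ l s r τ) (he : e = ∑ z, χ z) (b : β) :
    l b * e = l b := by
  rw [← h.l_mul b, mul_assoc, h.mul_sum he]

theorem sum_mul_r (h : IsFactorization K χ l s r τ) (he : e = ∑ z, χ z) (c : ρ) :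
    e * r c = r c := by
  rw [← h.mul_r c, ← mul_assoc, h.sum_mul he]

end Idempotent

/-- In a product `(l r)(l' r')` the middle part `r l'` begins with an idempotent, so it can be
rewritten as a combination of products in the order `l r`. Closure of the two families under
multiplication then absorbs the outer factors, keeping the middle idempotents matched. -/
theorem mul_chi_mul_mem (h : IsFactorization K χ l s r τ) (x y : R) (z : Z) :
    x * χ z * y ∈ Submodule.span K {w | ∃ b c, s b = τ c ∧ w = l b * r c} := by
  have key : ∀ b b' c c', s b = τ c → s b' = τ c' → l b * r c * (l b' * r c') ∈
      Submodule.span K {w | ∃ b c, s b = τ c ∧ w = l b * r c} := by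
    intro b b' c c' hbc hbc'
    have h₁ := h.chi_mul_mem (r c * l b') (τ c)
    rw [← mul_assoc, h.mul_r] at h₁
    rw [show l b * r c * (l b' * r c') = l b * (r c * l b') * r c' by simp only [mul_assoc]]
    generalize r c * l b' = w at h₁
    induction h₁ using Submodule.span_induction with
    | zero => simp
    | add u v _ _ hu hv =>
      rw [mul_add, add_mul]
      exact add_mem hu hv
    | smul k u _ hu =>
      rw [mul_smul_comm, smul_mul_assoc]
      exact Submodule.smul_mem _ _ hu
    | mem u hu =>
      obtain ⟨b₂, c₂, h₂, -, rfl⟩ := hu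
      rw [show l b * (l b₂ * r c₂) * r c' = (l b * l b₂) * (r c₂ * r c') by simp only [mul_assoc]]
      have h₃ := Submodule.mul_mem_mul (h.l_mul_l b b₂) (h.r_mul_r c₂ c')
      rw [Submodule.span_mul_span] at h₃
      refine Submodule.span_mono ?_ h₃
      rintro _ ⟨_, ⟨b₃, h₄, rfl⟩, _, ⟨c₃, h₅, rfl⟩, rfl⟩
      exact ⟨b₃, c₃, h₄.trans (h₂.trans h₅.symm), rfl⟩
  have h₁ := Submodule.mul_mem_mul (h.mul_chi_mem x z) (h.chi_mul_mem y z)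
  rw [← mul_assoc, mul_assoc x, h.idem, Submodule.span_mul_span] at h₁
  refine Submodule.span_le.2 ?_ h₁
  rintro _ ⟨_, ⟨b, c, hbc, -, rfl⟩, _, ⟨b', c', hbc', -, rfl⟩, rfl⟩
  exact key b b' c c' hbc hbc'

/-- Expanding each `p b` in the `r c` turns the relation into a linear relation between the
independent products `l b * r c`. This is the uniqueness part of freeness. -/
theorem eq_zero_of_sum_mul_eq_zero (h : IsFactorization K χ l s r τ) (B : Finset β) (p : β → R)
    (hp : ∀ b ∈ B, p b ∈ Submodule.span K (r '' {c | τ c = s b}))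
    (hsum : ∑ b ∈ B, l b * p b = 0) : ∀ b ∈ B, p b = 0 := by
  classical
  have h₁ : ∀ b : β, ∃ a : ρ →₀ K, b ∈ B →
      a ∈ Finsupp.supported K K {c | τ c = s b} ∧ Finsupp.linearCombination K r a = p b := by
    intro b
    by_cases hb : b ∈ B
    · obtain ⟨a, ha⟩ := Finsupp.mem_span_image_iff_linearCombination K |>.1 (hp b hb)
      exact ⟨a, fun _ => ha⟩
    · exact ⟨0, fun hb' => (hb hb').elim⟩
  choose a ha using h₁
  let F : β →₀ ρ →₀ K := Finsupp.onFinset B (fun b => if b ∈ B then a b else 0) (by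
    intro b hb
    by_contra hb'
    exact hb (if_neg hb'))
  have hF : ∀ b ∈ B, F b = a b := fun b hb => if_pos hb
  have hF' : ∀ b ∉ B, F b = 0 := fun b hb => if_neg hb
  have h₂ := linearIndepOn_iff.1 h.linIndep F.uncurry (by
    rw [Finsupp.mem_supported]
    rintro ⟨b, c⟩ hbc
    rw [Finset.mem_coe, Finsupp.mem_support_iff, Finsupp.uncurry_apply_pair] at hbc
    by_cases hb : b ∈ B
    · rw [hF b hb] at hbc
      exact ((Finsupp.mem_supported _ _).1 (ha b hb).1 (Finsupp.mem_support_iff.2 hbc)).symm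
    · rw [hF' b hb] at hbc
      exact (hbc rfl).elim) (by
    rw [Finsupp.linearCombination_apply, Finsupp.sum_uncurry_index]
    rw [Finsupp.sum_of_support_subset F Finsupp.support_onFinset_subset _ (by simp), ← hsum]
    refine Finset.sum_congr rfl fun b hb => ?_
    rw [hF b hb, ← (ha b hb).2, Finsupp.linearCombination_apply, Finsupp.mul_sum]
    exact Finsupp.sum_congr fun c _ => by simp)
  intro b hb
  have h₃ : a b = 0 := by
    ext c
    rw [← hF b hb, ← Finsupp.uncurry_apply_pair, h₂]
    rfl
  rw [← (ha b hb).2, h₃, map_zero]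

end IsFactorization

theorem mem_span_singleton_iff {K R : Type*} [Field K] [Ring R] [Algebra K R] {e x : R} :
    x ∈ TwoSidedIdeal.span {e} ↔ x ∈ Submodule.span K {y | ∃ a b, y = a * e * b} := by
  rw [TwoSidedIdeal.mem_span_iff_mem_addSubgroup_closure]
  constructor
  · intro hx
    induction hx using AddSubgroup.closure_induction with
    | mem x hx =>
      obtain ⟨_, ⟨a, -, _, rfl, rfl⟩, b, -, rfl⟩ := hx
      exact Submodule.subset_span ⟨a, b, rfl⟩
    | zero => exact zero_mem _
    | add x y _ _ hx hy => exact add_mem hx hy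
    | neg x _ hx => exact neg_mem hx
  · intro hx
    -- An additive closure is not visibly closed under scalars, so all scalar multiples are carried
    -- through the induction; on generators the scalar goes into the left factor.
    have : ∀ k : K, k • x ∈ AddSubgroup.closure (Set.univ * {e} * Set.univ) := by
      induction hx using Submodule.span_induction with
      | mem x hx =>
        obtain ⟨a, b, rfl⟩ := hx
        intro k
        rw [← smul_mul_assoc, ← smul_mul_assoc]
        exact AddSubgroup.subset_closure ⟨_, ⟨k • a, trivial, e, rfl, rfl⟩, b, trivial, rfl⟩
      | zero => simp
      | add x y _ _ hx hy =>
        intro k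
        rw [smul_add]
        exact add_mem (hx k) (hy k)
      | smul k' x _ hx =>
        intro k
        rw [smul_smul]
        exact hx _
    simpa using this 1

theorem injective_of_span_eq_top {K V W ι : Type*} [Field K] [AddCommGroup V] [Module K V]
    [AddCommGroup W] [Module K W] (f : V →ₗ[K] W) (v : ι → V)
    (hv : Submodule.span K (Set.range v) = ⊤) (hf : LinearIndependent K fun i => f (v i)) :
    Function.Injective f := by
  rw [injective_iff_map_eq_zero]
  intro x hx
  have hx' : x ∈ Submodule.span K (Set.range v) := hv ▸ Submodule.mem_top
  obtain ⟨a, rfl⟩ := Finsupp.mem_span_range_iff_exists_finsupp.1 hx'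
  have h₁ := linearIndependent_iff.1 hf a (by
    rw [← hx, Finsupp.linearCombination_apply, map_finsuppSum]
    simp)
  simp [h₁]

section Corner

variable (K : Type*) {R : Type*} [Field K] [Ring R] [Algebra K R] (e : R)

/-- The bilinear map `(x, y) ↦ x e ⊗ e y`. -/
def cornerTmul : R →ₗ[K] R →ₗ[K] CornerTensor K e :=
  ((TensorProduct.mk K (leftPart K e) (rightPart K e)).compr₂ (Submodule.mkQ _)).compl₁₂
    (LinearMap.mulRight K e).rangeRestrict (LinearMap.mulLeft K e).rangeRestrict

theorem span_range_cornerTmul :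
    Submodule.span K (Set.range fun x : R × R => cornerTmul K e x.1 x.2) = ⊤ := by
  rw [eq_top_iff]
  rintro x -
  obtain ⟨x, rfl⟩ := Submodule.mkQ_surjective _ x
  induction x using TensorProduct.induction_on with
  | zero => simp
  | add x y hx hy =>
    rw [map_add]
    exact add_mem hx hy
  | tmul m n =>
    obtain ⟨_, m, rfl⟩ := m
    obtain ⟨_, n, rfl⟩ := n
    exact Submodule.subset_span ⟨(m, n), rfl⟩

theorem cornerMul_cornerTmul (x y : R) :
    cornerMul K e (cornerTmul K e x y) = x * e * (e * y) := rfl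

variable {e}

theorem cornerTmul_mul_idem (he : e * e = e) (x y : R) :
    cornerTmul K e (x * e) y = cornerTmul K e x y := by
  have h : (LinearMap.mulRight K e).rangeRestrict (x * e)
      = (LinearMap.mulRight K e).rangeRestrict x := by
    apply Subtype.ext
    change x * e * e = x * e
    rw [mul_assoc, he]
  exact congrArg (fun m => (Submodule.Quotient.mk
    (m ⊗ₜ[K] (LinearMap.mulLeft K e).rangeRestrict y) : CornerTensor K e)) h

theorem cornerTmul_idem_mul (he : e * e = e) (x y : R) :
    cornerTmul K e x (e * y) = cornerTmul K e x y := by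
  have h : (LinearMap.mulLeft K e).rangeRestrict (e * y)
      = (LinearMap.mulLeft K e).rangeRestrict y := by
    apply Subtype.ext
    change e * (e * y) = e * y
    rw [← mul_assoc, he]
  exact congrArg (fun m => (Submodule.Quotient.mk
    ((LinearMap.mulRight K e).rangeRestrict x ⊗ₜ[K] m) : CornerTensor K e)) h

/-- The balancing relation for the corner element `e w e`, freed of the membership proofs. -/
theorem cornerTmul_mul (he : e * e = e) (x w y : R) :
    cornerTmul K e (x * e * w) y = cornerTmul K e x (w * e * y) := by
  have h : ∀ (m : leftPart K e) (r : corner K e) (n : rightPart K e),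
      (Submodule.Quotient.mk (cornerRight K e r m ⊗ₜ[K] n) : CornerTensor K e)
        = Submodule.Quotient.mk (m ⊗ₜ[K] cornerLeft K e r n) := fun m r n => by
    rw [Submodule.Quotient.eq]
    exact Submodule.subset_span ⟨_, _, _, rfl⟩
  have h₁ := h ((LinearMap.mulRight K e).rangeRestrict x) ⟨e * (w * e), w, rfl⟩
    ((LinearMap.mulLeft K e).rangeRestrict y)
  have h₂ : cornerRight K e ⟨e * (w * e), w, rfl⟩ ((LinearMap.mulRight K e).rangeRestrict x)
      = (LinearMap.mulRight K e).rangeRestrict (x * e * w) := by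
    apply Subtype.ext
    change x * e * (e * (w * e)) = x * e * w * e
    rw [← mul_assoc (x * e), mul_assoc x, he, ← mul_assoc]
  have h₃ : cornerLeft K e ⟨e * (w * e), w, rfl⟩ ((LinearMap.mulLeft K e).rangeRestrict y)
      = (LinearMap.mulLeft K e).rangeRestrict (w * e * y) := by
    apply Subtype.ext
    change e * (w * e) * (e * y) = e * (w * e * y)
    simp only [mul_assoc]
    rw [← mul_assoc e e, he]
  rw [h₂, h₃] at h₁
  exact h₁

theorem range_cornerMul (he : e * e = e) :
    Set.range (cornerMul K e) = (TwoSidedIdeal.span {e} : Set R) := by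
  ext x
  rw [SetLike.mem_coe, mem_span_singleton_iff (K := K)]
  constructor
  · rintro ⟨t, rfl⟩
    have ht : t ∈ Submodule.span K (Set.range fun x : R × R => cornerTmul K e x.1 x.2) :=
      span_range_cornerTmul K e ▸ Submodule.mem_top
    induction ht using Submodule.span_induction with
    | zero => simp
    | add x y _ _ hx hy =>
      rw [map_add]
      exact add_mem hx hy
    | smul k x _ hx =>
      rw [map_smul]
      exact Submodule.smul_mem _ _ hx
    | mem x hx =>
      obtain ⟨⟨x, y⟩, rfl⟩ := hx
      refine Submodule.subset_span ⟨x, y, ?_⟩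
      rw [cornerMul_cornerTmul, ← mul_assoc, mul_assoc x, he]
  · intro hx
    change x ∈ LinearMap.range (cornerMul K e)
    refine Submodule.span_le.2 ?_ hx
    rintro _ ⟨a, b, rfl⟩
    exact ⟨cornerTmul K e a b, by rw [cornerMul_cornerTmul, ← mul_assoc, mul_assoc a, he]⟩

end Corner

/-- The tensors `l ⊗ r` with matching idempotents span the tensor product, and their images `l r`
are independent. -/
theorem IsFactorization.injective_cornerMul {K R Z β ρ : Type*} [Field K] [Ring R] [Algebra K R]
    {χ : Z → R} {l : β → R} {s : β → Z} {r : ρ → R} {τ : ρ → Z} [Fintype Z] {e : R}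
    (h : IsFactorization K χ l s r τ) (he : e = ∑ z, χ z) :
    Function.Injective (cornerMul K e) := by
  have hee := h.sum_mul_sum he
  refine injective_of_span_eq_top _
    (fun x : {x : β × ρ | s x.1 = τ x.2} => cornerTmul K e (l x.1.1) (r x.1.2)) ?_ ?_
  · rw [eq_top_iff, ← span_range_cornerTmul, Submodule.span_le]
    set V := Submodule.span K (Set.range fun x : {x : β × ρ | s x.1 = τ x.2} =>
      cornerTmul K e (l x.1.1) (r x.1.2))
    -- Moves `l b'` to the left factor, where `l b * l b'` is again a combination of low elements
    -- with the same source.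
    have h₁ : ∀ b b' c', s b' = τ c' → cornerTmul K e (l b) (l b' * r c') ∈ V := by
      intro b b' c' hbc
      have h₂ := cornerTmul_mul K hee (l b) (l b') (r c')
      rw [h.l_mul_sum he, h.l_mul_sum he] at h₂
      rw [← h₂]
      have h₃ := h.l_mul_l b b'
      generalize l b * l b' = w at h₃
      change w ∈ V.comap ((cornerTmul K e).flip (r c'))
      refine Submodule.span_le.2 ?_ h₃
      rintro _ ⟨b'', hb'', rfl⟩
      exact Submodule.subset_span ⟨⟨(b'', c'), Eq.trans hb'' hbc⟩, rfl⟩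
    have h₂ : ∀ b y, cornerTmul K e (l b) y ∈ V := by
      intro b y
      have hy : e * y = ∑ z, χ z * y := by rw [he, Finset.sum_mul]
      rw [← cornerTmul_idem_mul K hee, hy, map_sum]
      refine sum_mem fun z _ => ?_
      change _ ∈ V.comap (cornerTmul K e (l b))
      refine Submodule.span_le.2 ?_ (h.chi_mul_mem y z)
      rintro _ ⟨b', c', hbc, -, rfl⟩
      exact h₁ b b' c' hbc
    rintro _ ⟨⟨x, y⟩, rfl⟩
    change cornerTmul K e x y ∈ V
    have hx : x * e = ∑ z, x * χ z := by rw [he, Finset.mul_sum]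
    rw [← cornerTmul_mul_idem K hee, hx, map_sum, LinearMap.sum_apply]
    refine sum_mem fun z _ => ?_
    change _ ∈ V.comap ((cornerTmul K e).flip y)
    refine Submodule.span_le.2 ?_ (h.mul_chi_mem x z)
    rintro _ ⟨b, c, hbc, -, rfl⟩
    change cornerTmul K e (l b * r c) y ∈ V
    -- Moves `r c` to the right factor; what remains has the form treated in `h₂`.
    have h₃ := cornerTmul_mul K hee (l b) (r c) y
    rw [h.l_mul_sum he] at h₃
    rw [h₃]
    exact h₂ _ _
  · have h₃ : (fun x : {x : β × ρ | s x.1 = τ x.2} =>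
        cornerMul K e (cornerTmul K e (l x.1.1) (r x.1.2))) = fun x => l x.1.1 * r x.1.2 := by
      funext x
      rw [cornerMul_cornerTmul, h.l_mul_sum he, h.sum_mul_r he]
    rw [h₃]
    exact h.linIndep

end Factorization

/-! ### From a factorization to vanishing of Ext for `R / R e R` -/

section FactorizationExt

open CategoryTheory Abelian

universe u

variable {K : Type*} {Λ R : Type u} {Z β ρ : Type*} [Field K] [Ring Λ] [Ring R] [Algebra K R]
  [Module Λ R] [IsScalarTower Λ R R]
  {χ : Z → R} {l : β → R} {s : β → Z} {r : ρ → R} {τ : ρ → Z}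

theorem smul_eq_mul_of_smul_one {a : Λ} {x : R} (ha : a • (1 : R) = x) (y : R) : a • y = x * y := by
  rw [← ha, smul_mul_assoc, one_mul]

/-- The left ideal `R f`, for an idempotent `f`, as a module over `Λ`. -/
def fixedLeft (Λ : Type u) {R : Type u} [Ring Λ] [Ring R] [Module Λ R] [IsScalarTower Λ R R]
    (f : R) : Submodule Λ R where
  carrier := {x | x * f = x}
  zero_mem' := zero_mul f
  add_mem' {x y} hx hy := by
    rw [Set.mem_ofPred_eq, add_mul, hx, hy]
  smul_mem' a x hx := by
    rw [Set.mem_ofPred_eq, smul_mul_assoc, hx]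

variable (K) in
/-- The part of the left ideal `W` that consists of combinations of the `r c` with target `z`. -/
def leftFamily (r : ρ → R) (τ : ρ → Z) (W : Submodule Λ R) (z : Z) : AddSubgroup W :=
  (Submodule.span K (r '' {c | τ c = z})).toAddSubgroup.comap W.subtype.toAddMonoidHom

namespace IsFactorization

theorem chi_mul_of_mem (h : IsFactorization K χ l s r τ) {z : Z} {x : R}
    (hx : x ∈ Submodule.span K (r '' {c | τ c = z})) : χ z * x = x := by
  induction hx using Submodule.span_induction with
  | mem x hx =>
    obtain ⟨c, rfl, rfl⟩ := hx
    exact h.mul_r c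
  | zero => simp
  | add x y _ _ hx hy => rw [mul_add, hx, hy]
  | smul k x _ hx => rw [mul_smul_comm, hx]

theorem mul_mem_span_r (h : IsFactorization K χ l s r τ) {z z' : Z} {x y : R}
    (hx : x ∈ Submodule.span K (r '' {c | τ c = z}))
    (hy : y ∈ Submodule.span K (r '' {c | τ c = z'})) :
    x * y ∈ Submodule.span K (r '' {c | τ c = z}) := by
  have h₁ := Submodule.mul_mem_mul hx hy
  rw [Submodule.span_mul_span] at h₁
  refine Submodule.span_le.2 ?_ h₁
  rintro _ ⟨_, ⟨c, rfl, rfl⟩, _, ⟨c', rfl, rfl⟩, rfl⟩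
  exact h.r_mul_r c c'

theorem span_chi (h : IsFactorization K χ l s r τ)
    (hsurj : ∀ x : R, ∃ a : Λ, a • (1 : R) = x) (z : Z) : Submodule.span Λ
    {(⟨χ z, h.idem z⟩ : fixedLeft Λ (χ z))} = ⊤ := by
  rw [eq_top_iff]
  rintro ⟨x, hx⟩ -
  obtain ⟨a, ha⟩ := hsurj x
  refine Submodule.mem_span_singleton.2 ⟨a, Subtype.ext ?_⟩
  change a • χ z = x
  rw [smul_eq_mul_of_smul_one ha]
  exact hx

/-- Grouping the products `l b * r c` by `b` gives existence of coefficients, and independence of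
these products gives uniqueness. The required morphism `R χ_z → W` is right multiplication by `x`,
which sends `χ_z` to `x` because `x` is a combination of elements with target `z`. The lemma serves
both `W = R χ_z` and `W = R e R`. -/
theorem isFreeOver_leftIdeal (h : IsFactorization K χ l s r τ)
    (hsurj : ∀ x : R, ∃ a : Λ, a • (1 : R) = x)
    {l' : β → Λ} (hl' : ∀ b, l' b • (1 : R) = l b) (W : Submodule Λ R)
    (hW : ∀ x ∈ W, x ∈ Submodule.span K {y | ∃ b c, s b = τ c ∧ r c ∈ W ∧ y = l b * r c}) :
    IsFreeOver (fun z => fixedLeft Λ (χ z)) (fun z => ⟨χ z, h.idem z⟩)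
      (fun z => leftFamily K r τ (fixedLeft Λ (χ z))) l' s (leftFamily K r τ W) := by
  have hmul : ∀ (u x : R), x ∈ W → u * x ∈ W := by
    intro u x hx
    obtain ⟨a, ha⟩ := hsurj u
    rw [← smul_eq_mul_of_smul_one ha]
    exact W.smul_mem a hx
  have hcoe : ∀ p : β →₀ W, ((p.sum fun b y => l' b • y : W) : R)
      = ∑ b ∈ p.support, l b * (p b : R) := by
    intro p
    rw [Finsupp.sum, Submodule.coe_sum]
    exact Finset.sum_congr rfl fun b _ => smul_eq_mul_of_smul_one (hl' b) _
  refine ⟨fun z x hx => ?_, fun x => ?_, fun p hp h₀ => ?_⟩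
  · refine ⟨{ toFun := fun u => ⟨u.1 * x.1, hmul _ _ x.2⟩
              map_add' := fun u v => Subtype.ext (add_mul _ _ _)
              map_smul' := fun a u => Subtype.ext (smul_mul_assoc _ _ _) },
      Subtype.ext (h.chi_mul_of_mem hx), fun z' y hy => ?_⟩
    exact h.mul_mem_span_r hy hx
  -- `W` is only given as a `Λ`-submodule, so scalars of `K` are carried through the induction.
  · have key : ∀ k : K, ∃ p : β →₀ W, (∀ b, p b ∈ leftFamily K r τ W (s b)) ∧
        ((p.sum fun b y => l' b • y : W) : R) = k • (x : R) := by
      have hx := hW x x.2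
      generalize (x : R) = x at hx
      induction hx using Submodule.span_induction with
      | zero =>
        intro k
        exact ⟨0, fun b => zero_mem _, by simp⟩
      | add x y _ _ hx hy =>
        intro k
        obtain ⟨p, hp, hpx⟩ := hx k
        obtain ⟨q, hq, hqy⟩ := hy k
        refine ⟨p + q, fun b => add_mem (hp b) (hq b), ?_⟩
        rw [Finsupp.sum_add_index' (by simp) (by simp), Submodule.coe_add, hpx, hqy, smul_add]
      | smul k' x _ hx =>
        intro k
        obtain ⟨p, hp, hpx⟩ := hx (k * k')
        exact ⟨p, hp, by rw [hpx, mul_smul]⟩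
      | mem x hx =>
        intro k
        obtain ⟨b, c, hbc, hc, rfl⟩ := hx
        have hkc : k • r c ∈ W := by
          have := hmul (k • (1 : R)) _ hc
          rwa [smul_mul_assoc, one_mul] at this
        classical
        refine ⟨Finsupp.single b ⟨k • r c, hkc⟩, fun b' => ?_, ?_⟩
        · by_cases hb : b = b'
          · subst hb
            rw [Finsupp.single_eq_same]
            change k • r c ∈ Submodule.span K (r '' {c | τ c = s b})
            refine Submodule.smul_mem _ k (Submodule.subset_span ?_)
            exact ⟨c, hbc.symm, rfl⟩
          · rw [Finsupp.single_eq_of_ne (Ne.symm hb)]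
            exact zero_mem _
        · rw [Finsupp.sum_single_index (by simp), Submodule.coe_smul,
            smul_eq_mul_of_smul_one (hl' b), mul_smul_comm]
    obtain ⟨p, hp, hpx⟩ := key 1
    exact ⟨p, hp, Subtype.ext (by rw [hpx, one_smul])⟩
  · have h₁ := h.eq_zero_of_sum_mul_eq_zero p.support (fun b => (p b : R)) (fun b _ => hp b)
      (by rw [← hcoe, h₀]; rfl)
    ext b
    by_cases hb : b ∈ p.support
    · exact h₁ b hb
    · rw [Finsupp.notMem_support_iff.1 hb]
      rfl

/-- One step of the chain: vanishing of extensions passes from `R` to `R / R e R`. -/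
theorem subsingleton_ext_quotient (h : IsFactorization K χ l s r τ)
    (hsurj : ∀ x : R, ∃ a : Λ, a • (1 : R) = x)
    [Fintype Z] {e : R} (he : e = ∑ z, χ z) {N : ModuleCat.{u} Λ}
    (hN : ∀ z, ∃ a : Λ, a • (1 : R) = χ z ∧ ∀ n : N, a • n = 0)
    (hR : ∀ i, Subsingleton (Ext (ModuleCat.of Λ R) N (i + 1)))
    {Q : Type u} [AddCommGroup Q] [Module Λ Q] (q : R →ₗ[Λ] Q) (hq : Function.Surjective q)
    (hker : ∀ x, q x = 0 ↔ x ∈ TwoSidedIdeal.span {e}) (i : ℕ) :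
    Subsingleton (Ext (ModuleCat.of Λ Q) N (i + 1)) := by
  choose l' hl' using fun b => hsurj (l b)
  have hchi : ∀ z, χ z ∈ LinearMap.ker q := by
    intro z
    rw [LinearMap.mem_ker, hker, ← h.mul_sum he]
    exact TwoSidedIdeal.mul_mem_left _ _ _ (TwoSidedIdeal.subset_span rfl)
  have hr : ∀ c, r c ∈ LinearMap.ker q := by
    intro c
    rw [LinearMap.mem_ker, hker, ← h.mul_r]
    exact TwoSidedIdeal.mul_mem_right _ _ _ ((hker _).1 (hchi _))
  -- It remains to treat the kernel `R e R` in degree `i`, where `i = 0` is included.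
  refine subsingleton_ext_succ_of_surjective q hq i ?_ (hR i)
  refine subsingleton_ext_of_isFreeOver (h.span_chi hsurj)
    (fun z => h.isFreeOver_leftIdeal hsurj hl' _ ?_) ?_ i
    (h.isFreeOver_leftIdeal hsurj hl' (LinearMap.ker q) ?_)
  · intro x hx
    have h₁ := h.mul_chi_mem x z
    rw [show x * χ z = x from hx] at h₁
    refine Submodule.span_mono ?_ h₁
    rintro _ ⟨b, c, hbc, hc, rfl⟩
    exact ⟨b, c, hbc, hc, rfl⟩
  -- For `R χ_z` degree zero vanishes because `χ_z` kills `N`, and positive degrees vanish because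
  -- `R χ_z` is a direct summand of `R`.
  · intro z i
    cases i with
    | zero =>
      obtain ⟨a, ha, han⟩ := hN z
      refine subsingleton_ext_zero fun φ => LinearMap.ext_on (h.span_chi hsurj z) ?_
      rintro _ rfl
      rw [LinearMap.zero_apply, ← han (φ ⟨χ z, h.idem z⟩), ← map_smul]
      congr 1
      apply Subtype.ext
      change χ z = a • χ z
      rw [smul_eq_mul_of_smul_one ha, h.idem]
    | succ i =>
      exact subsingleton_ext_of_retract (fixedLeft Λ (χ z)).subtype
        { toFun := fun x => ⟨x * χ z, by
            change x * χ z * χ z = x * χ z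
            rw [mul_assoc, h.idem]⟩
          map_add' := fun x y => Subtype.ext (add_mul _ _ _)
          map_smul' := fun a x => Subtype.ext (smul_mul_assoc _ _ _) }
        (fun w => Subtype.ext w.2) (i + 1) (hR i)
  · intro x hx
    rw [LinearMap.mem_ker, hker, mem_span_singleton_iff (K := K)] at hx
    refine Submodule.span_le.2 ?_ hx
    rintro _ ⟨a, b, rfl⟩
    rw [he, Finset.mul_sum, Finset.sum_mul]
    refine sum_mem fun z _ => Submodule.span_mono ?_ (h.mul_chi_mul_mem a b z)
    rintro _ ⟨b, c, hbc, rfl⟩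
    exact ⟨b, c, hbc, hr c, rfl⟩

end IsFactorization

end FactorizationExt

/-! ### Products of basis elements over half-open index ranges -/

section Segments

/-- The list of the indices `k` with `a ≤ k < b`. -/
def segment (m a b : ℕ) : List (Fin m) :=
  (List.finRange m).filter fun k => a ≤ (k : ℕ) ∧ (k : ℕ) < b

theorem mem_segment {m a b : ℕ} {k : Fin m} : k ∈ segment m a b ↔ a ≤ (k : ℕ) ∧ (k : ℕ) < b := by
  simp [segment]

theorem nodup_segment (m a b : ℕ) : (segment m a b).Nodup :=
  (List.nodup_finRange m).filter _

theorem segment_append {m a b c : ℕ} (hab : a ≤ b) (hbc : b ≤ c) :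
    segment m a b ++ segment m b c = segment m a c := by
  have key : ∀ L : List (Fin m), L.Pairwise (· < ·) →
      (L.filter fun k : Fin m => a ≤ (k : ℕ) ∧ (k : ℕ) < b) ++
          (L.filter fun k : Fin m => b ≤ (k : ℕ) ∧ (k : ℕ) < c)
        = L.filter fun k : Fin m => a ≤ (k : ℕ) ∧ (k : ℕ) < c := by
    intro L hL
    induction L with
    | nil => rfl
    | cons x L ih =>
      rw [List.pairwise_cons] at hL
      have ih := ih hL.2
      by_cases hx : (x : ℕ) < b
      · by_cases hax : a ≤ (x : ℕ)
        · rw [List.filter_cons_of_pos (by simp [hx, hax]), List.filter_cons_of_neg (by simp; omega),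
            List.filter_cons_of_pos (by simp; omega), List.cons_append, ih]
        · rw [List.filter_cons_of_neg (by simp; omega), List.filter_cons_of_neg (by simp; omega),
            List.filter_cons_of_neg (by simp; omega), ih]
      · have h₁ : (L.filter fun k : Fin m => a ≤ (k : ℕ) ∧ (k : ℕ) < b) = [] := by
          rw [List.filter_eq_nil_iff]
          intro k hk
          have := hL.1 k hk
          simp only [decide_eq_true_eq]
          omega
        rw [h₁, List.nil_append] at ih
        rw [List.filter_cons_of_neg (by simp; omega), h₁, List.nil_append]
        by_cases hxc : (x : ℕ) < c
        · rw [List.filter_cons_of_pos (by simp; omega), List.filter_cons_of_pos (by simp; omega), ih]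
        · rw [List.filter_cons_of_neg (by simp; omega), List.filter_cons_of_neg (by simp; omega), ih]
  exact key _ (List.pairwise_lt_finRange m)

theorem segment_zero (m : ℕ) : segment m 0 m = List.finRange m := by
  rw [segment, List.filter_eq_self]
  simp

theorem segment_self (m a : ℕ) : segment m a a = [] := by
  rw [segment, List.filter_eq_nil_iff]
  simp

theorem segment_succ {m : ℕ} (k : Fin m) : segment m k (k + 1) = [k] := by
  have h₁ : ∀ x ∈ segment m k (k + 1), x = k := fun x hx => by
    rw [mem_segment] at hx
    exact Fin.ext (by omega)
  have h₂ : k ∈ segment m k (k + 1) := by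
    rw [mem_segment]
    omega
  have h₃ := nodup_segment m k (k + 1)
  generalize segment m k (k + 1) = L at h₁ h₂ h₃
  match L with
  | [] => simp at h₂
  | [x] => rw [h₁ x (by simp)]
  | x :: y :: L =>
    rw [h₁ x (by simp), h₁ y (by simp)] at h₃
    simp at h₃

variable {K A Γ : Type*} [Field K] [Ring A] [Algebra K A] [AddCommMonoid Γ]
  {m : ℕ} {As : Fin m → Submodule K A} {ι : Fin m → Type*}
  (J : ∀ i, Module.Basis (ι i) K (As i)) (d : ∀ i, ι i → Γ)

/-- The product of the basis elements with indices in `[a, b)`. -/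
def segProd (f : ∀ k, ι k) (a b : ℕ) : A :=
  ((segment m a b).map fun k => (J k (f k) : A)).prod

/-- The sum of the degrees of the basis elements with indices in `[a, b)`. -/
def segDeg (f : ∀ k, ι k) (a b : ℕ) : Γ :=
  ((segment m a b).map fun k => d k (f k)).sum

/-- The product of the subspaces with indices in `[a, b)`. -/
def segSub (As : Fin m → Submodule K A) (a b : ℕ) : Submodule K A :=
  ((segment m a b).map As).prod

/-- The family that agrees with `f` below `p` and with `g` from `p` on. -/
def merge (p : ℕ) (f g : ∀ k, ι k) : ∀ k, ι k := fun k => if (k : ℕ) < p then f k else g k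

theorem segProd_mul (f : ∀ k, ι k) {a b c : ℕ} (hab : a ≤ b) (hbc : b ≤ c) :
    segProd J f a b * segProd J f b c = segProd J f a c := by
  rw [segProd, segProd, segProd, ← segment_append hab hbc, List.map_append, List.prod_append]

theorem segDeg_add (f : ∀ k, ι k) {a b c : ℕ} (hab : a ≤ b) (hbc : b ≤ c) :
    segDeg d f a b + segDeg d f b c = segDeg d f a c := by
  rw [segDeg, segDeg, segDeg, ← segment_append hab hbc, List.map_append, List.sum_append]

theorem segDeg_self (f : ∀ k, ι k) (a : ℕ) : segDeg d f a a = 0 := by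
  simp [segDeg, segment_self]

theorem segDeg_succ (f : ∀ k, ι k) (k : Fin m) : segDeg d f k (k + 1) = d k (f k) := by
  simp [segDeg, segment_succ]

theorem segProd_zero (f : ∀ k, ι k) :
    segProd J f 0 m = (List.ofFn fun k => (J k (f k) : A)).prod := by
  rw [segProd, segment_zero, List.ofFn_eq_map]

theorem segDeg_eq_sum (f : ∀ k, ι k) (k : Fin m) :
    segDeg d f k m = ∑ l ∈ Finset.Ici k, d l (f l) := by
  rw [segDeg, ← List.sum_toFinset _ (nodup_segment m k m)]
  refine Finset.sum_congr ?_ fun _ _ => rfl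
  ext l
  simp [mem_segment]

theorem segProd_congr {f g : ∀ k, ι k} {a b : ℕ} (h : ∀ k : Fin m, a ≤ k → (k : ℕ) < b → f k = g k) :
    segProd J f a b = segProd J g a b := by
  unfold segProd
  congr 1
  refine List.map_congr_left fun k hk => ?_
  rw [mem_segment] at hk
  rw [h k hk.1 hk.2]

theorem segDeg_congr {f g : ∀ k, ι k} {a b : ℕ} (h : ∀ k : Fin m, a ≤ k → (k : ℕ) < b → f k = g k) :
    segDeg d f a b = segDeg d g a b := by
  unfold segDeg
  congr 1
  refine List.map_congr_left fun k hk => ?_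
  rw [mem_segment] at hk
  rw [h k hk.1 hk.2]

theorem segProd_merge_low (f g : ∀ k, ι k) {a b p : ℕ} (hb : b ≤ p) :
    segProd J (merge p f g) a b = segProd J f a b :=
  segProd_congr J fun _ _ hk => if_pos (hk.trans_le hb)

theorem segProd_merge_high (f g : ∀ k, ι k) {a b p : ℕ} (ha : p ≤ a) :
    segProd J (merge p f g) a b = segProd J g a b :=
  segProd_congr J fun _ hk _ => if_neg (ha.trans hk).not_gt

theorem segDeg_merge_low (f g : ∀ k, ι k) {a b p : ℕ} (hb : b ≤ p) :
    segDeg d (merge p f g) a b = segDeg d f a b :=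
  segDeg_congr d fun _ _ hk => if_pos (hk.trans_le hb)

theorem segDeg_merge_high (f g : ∀ k, ι k) {a b p : ℕ} (ha : p ≤ a) :
    segDeg d (merge p f g) a b = segDeg d g a b :=
  segDeg_congr d fun _ hk _ => if_neg (ha.trans hk).not_gt

theorem segProd_mul_segProd (f g : ∀ k, ι k) {p : ℕ} (hp : p ≤ m) :
    segProd J f 0 p * segProd J g p m = segProd J (merge p f g) 0 m := by
  rw [← segProd_mul J _ (Nat.zero_le p) hp, segProd_merge_low J f g le_rfl,
    segProd_merge_high J f g le_rfl]

theorem segProd_mem [DecidableEq Γ] (𝒜 : Γ → Submodule K A) [GradedAlgebra 𝒜] {d : ∀ i, ι i → Γ}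
    (hJ : ∀ i k, (J i k : A) ∈ 𝒜 (d i k)) (f : ∀ k, ι k) (a b : ℕ) :
    segProd J f a b ∈ 𝒜 (segDeg d f a b) :=
  SetLike.list_prod_map_mem_graded _ _ _ fun k _ => hJ k (f k)

theorem list_prod_mem_list_prod {α : Type*} (L : List α) (M : α → Submodule K A) (x : α → A)
    (hx : ∀ k, x k ∈ M k) : (L.map x).prod ∈ (L.map M).prod := by
  induction L with
  | nil => exact Submodule.one_le.1 le_rfl
  | cons k L ih =>
    rw [List.map_cons, List.map_cons, List.prod_cons, List.prod_cons]
    exact Submodule.mul_mem_mul (hx k) ih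

theorem segProd_mem_segSub (f : ∀ k, ι k) (a b : ℕ) : segProd J f a b ∈ segSub As a b :=
  list_prod_mem_list_prod _ _ _ fun k => (J k (f k)).2

theorem list_prod_le_span [Nonempty (∀ k, ι k)] (L : List (Fin m)) (hL : L.Nodup) :
    (L.map As).prod ≤
      Submodule.span K (Set.range fun f : ∀ k, ι k => (L.map fun k => (J k (f k) : A)).prod) := by
  induction L with
  | nil =>
    rw [List.map_nil, List.prod_nil, Submodule.one_eq_span, Submodule.span_le]
    rintro _ rfl
    exact Submodule.subset_span ⟨Classical.arbitrary _, by simp⟩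
  | cons k L ih =>
    rw [List.nodup_cons] at hL
    have h₁ : As k ≤ Submodule.span K (Set.range fun i => (J k i : A)) := by
      intro x hx
      have h₂ := (J k).mem_span ⟨x, hx⟩
      have h₃ := Submodule.mem_map_of_mem (f := (As k).subtype) h₂
      rw [Submodule.map_span, ← Set.range_comp] at h₃
      exact h₃
    rw [List.map_cons, List.prod_cons]
    refine (mul_le_mul' h₁ (ih hL.2)).trans ?_
    rw [Submodule.span_mul_span]
    refine Submodule.span_mono ?_
    rintro _ ⟨_, ⟨i, rfl⟩, _, ⟨f, rfl⟩, rfl⟩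
    classical
    refine ⟨Function.update f k i, ?_⟩
    change (List.map _ (k :: L)).prod = _
    rw [List.map_cons, List.prod_cons, Function.update_self]
    congr 2
    refine List.map_congr_left fun k' hk' => ?_
    rw [Function.update_of_ne]
    rintro rfl
    exact hL.1 hk'

theorem segSub_eq_span (h1 : ∀ k, (1 : A) ∈ As k) (a b : ℕ) :
    segSub As a b = Submodule.span K (Set.range fun f => segProd J f a b) := by
  apply le_antisymm
  · by_cases h : Nonempty (∀ k, ι k)
    · exact list_prod_le_span J _ (nodup_segment m a b)
    · rw [not_nonempty_iff, isEmpty_pi] at h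
      obtain ⟨k, hk⟩ := h
      -- An empty basis forces `As k = 0`; since `1` belongs to it, the whole algebra is zero.
      have h₁ : (⟨1, h1 k⟩ : As k) = 0 := by
        refine (J k).ext_elem fun i => ?_
        exact hk.elim i
      have h₂ : (1 : A) = 0 := congrArg Subtype.val h₁
      intro x _
      rw [← mul_one x, h₂, mul_zero]
      exact zero_mem _
  · rw [Submodule.span_le]
    rintro _ ⟨f, rfl⟩
    exact segProd_mem_segSub J f a b

/-- Projection to the component of degree `γ` fixes `a` and kills the generators of other degrees.
Keeping the degree is what lets the endpoints of paths survive each expansion in a basis. -/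
theorem mem_span_of_homogeneous [DecidableEq Γ] (𝒜 : Γ → Submodule K A) [GradedAlgebra 𝒜]
    {X : Type*} {v : X → A} {δ : X → Γ} (hv : ∀ x, v x ∈ 𝒜 (δ x)) {γ : Γ} {a : A} (ha : a ∈ 𝒜 γ)
    (hav : a ∈ Submodule.span K (Set.range v)) : a ∈ Submodule.span K (v '' {x | δ x = γ}) := by
  have key : ((DirectSum.decompose 𝒜 a) γ : A) ∈ Submodule.span K (v '' {x | δ x = γ}) := by
    clear ha
    induction hav using Submodule.span_induction with
    | zero => simp
    | add x y _ _ hx hy =>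
      rw [DirectSum.decompose_add]
      exact add_mem hx hy
    | smul k x _ hx =>
      rw [DirectSum.decompose_smul]
      exact Submodule.smul_mem _ _ hx
    | mem x hx =>
      obtain ⟨i, rfl⟩ := hx
      by_cases hi : δ i = γ
      · subst hi
        rw [DirectSum.decompose_of_mem_same _ (hv i)]
        exact Submodule.subset_span ⟨i, rfl, rfl⟩
      · rw [DirectSum.decompose_of_mem_ne _ (hv i) hi]
        exact zero_mem _
  rwa [DirectSum.decompose_of_mem_same _ ha] at key

theorem interval_eq_segSub (i j : Fin m) : interval As i j = segSub As i (j + 1) := by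
  unfold interval segSub segment
  congr 3
  ext k
  simp only [decide_eq_decide, Fin.le_def]
  omega

/-- The basis of `A` given by the products of the elements of the bases of the `As i`. -/
def prodBasis (hA : Function.Bijective (prodMap As)) : Module.Basis (∀ k, ι k) K A :=
  (Basis.piTensorProduct J).map (LinearEquiv.ofBijective (prodMap As) hA)

theorem prodBasis_apply (hA : Function.Bijective (prodMap As)) (f : ∀ k, ι k) :
    prodBasis J hA f = segProd J f 0 m := by
  rw [prodBasis, Module.Basis.map_apply, Basis.piTensorProduct_apply, segProd_zero]
  simp [prodMap]

end Segments

/-! ### Paths of degrees through the strata, and products whose paths leave a lower union -/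

section Paths

/-- The union of the sets `Z k` with `k < p`. -/
def lowerUnion {m : ℕ} {S : Type*} (Z : Fin m → Set S) (p : ℕ) : Set S :=
  {y | ∃ k : Fin m, (k : ℕ) < p ∧ y ∈ Z k}

theorem lowerUnion_mono {m : ℕ} {S : Type*} (Z : Fin m → Set S) {p q : ℕ} (hpq : p ≤ q) :
    lowerUnion Z p ⊆ lowerUnion Z q := fun _ ⟨k, hk, hy⟩ => ⟨k, hk.trans_le hpq, hy⟩

section

variable {Γ S : Type*} [AddCommMonoid Γ] [AddAction Γ S] {m : ℕ} {ι : Fin m → Type*}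
  {d : ∀ i, ι i → Γ}

theorem segDeg_vadd_segDeg_vadd (f : ∀ k, ι k) {a b c : ℕ} (hab : a ≤ b) (hbc : b ≤ c) (y : S) :
    segDeg d f a b +ᵥ (segDeg d f b c +ᵥ y) = segDeg d f a c +ᵥ y := by
  rw [← add_vadd, segDeg_add d f hab hbc]

theorem segDeg_step (f : ∀ k, ι k) (k : Fin m) {c : ℕ} (hc : (k : ℕ) + 1 ≤ c) (y : S) :
    segDeg d f k c +ᵥ y = d k (f k) +ᵥ (segDeg d f (k + 1) c +ᵥ y) := by
  rw [← segDeg_vadd_segDeg_vadd f (Nat.le_succ (k : ℕ)) hc, Nat.succ_eq_add_one, segDeg_succ]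

end

variable {K A Γ S : Type*} [Field K] [Ring A] [Algebra K A] [AddCommMonoid Γ] [DecidableEq Γ]
  [AddAction Γ S] {m : ℕ} {As : Fin m → Submodule K A} {ι : Fin m → Type*}

/-- The hypotheses on a graded algebra with a decomposition and on a convex set with a
stratification, in terms of homogeneous bases. -/
structure IsConvexDecomposition (𝒜 : Γ → Submodule K A) [GradedAlgebra 𝒜]
    (J : ∀ i, Module.Basis (ι i) K (As i)) (d : ∀ i, ι i → Γ) (Z : Fin m → Set S) : Prop where
  homogeneous : ∀ i k, (J i k : A) ∈ 𝒜 (d i k)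
  bijective : Function.Bijective (prodMap As)
  one_mem : ∀ k, (1 : A) ∈ As k
  mul_low : ∀ p, 0 < p → p < m → ∀ x ∈ segSub As 0 p, ∀ y ∈ segSub As 0 p, x * y ∈ segSub As 0 p
  mul_high : ∀ p, 0 < p → p < m → ∀ x ∈ segSub As p m, ∀ y ∈ segSub As p m, x * y ∈ segSub As p m
  finite : (lowerUnion Z m).Finite
  convex : IsGammaConvex Γ (lowerUnion Z m)
  stable_low : ∀ (k : Fin m) (i : ι k) (p : ℕ) (y : S), (k : ℕ) < p → p ≤ m →
    y ∈ lowerUnion Z p → d k i +ᵥ y ∈ lowerUnion Z m → d k i +ᵥ y ∈ lowerUnion Z p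
  stable_high : ∀ (k : Fin m) (i : ι k) (p : ℕ) (y : S), p ≤ (k : ℕ) →
    y ∈ lowerUnion Z (p + 1) → y ∉ lowerUnion Z p → d k i +ᵥ y ∉ lowerUnion Z p

namespace IsConvexDecomposition

variable {𝒜 : Γ → Submodule K A} [GradedAlgebra 𝒜] {J : ∀ i, Module.Basis (ι i) K (As i)}
  {d : ∀ i, ι i → Γ} {Z : Fin m → Set S}

/-- A path of degrees below `p` does not leave the lower union of level `p`. -/
theorem segDeg_vadd_mem_lowerUnion (h : IsConvexDecomposition 𝒜 J d Z) (f : ∀ k, ι k) {p : ℕ}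
    (hp : p ≤ m) {z : S} (hz : z ∈ lowerUnion Z p) (n : ℕ) :
    ∀ a, a + n = p → (∀ k, a ≤ k → k ≤ p → segDeg d f k p +ᵥ z ∈ lowerUnion Z m) →
      segDeg d f a p +ᵥ z ∈ lowerUnion Z p := by
  induction n with
  | zero =>
    intro a ha _
    obtain rfl : a = p := by omega
    rwa [segDeg_self, zero_vadd]
  | succ n ih =>
    intro a ha hY
    have h₁ := ih (a + 1) (by omega) fun k hk => hY k (by omega)
    have h₂ := hY a le_rfl (by omega)
    -- The induction runs downwards in `a`: the factor of index `a` acts on the point reached by the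
    -- factors from `a + 1` on.
    have h₃ := segDeg_step (d := d) f ⟨a, by omega⟩ (c := p) (by simp; omega) z
    simp only at h₃
    rw [h₃] at h₂ ⊢
    exact h.stable_low _ _ _ _ (by simp; omega) hp h₁ h₂

/-- A path of degrees from `p` on that starts in the `p`-th stratum and stays in the lower union of
level `p + 1` ends in the `p`-th stratum. -/
theorem segDeg_vadd_notMem_lowerUnion (h : IsConvexDecomposition 𝒜 J d Z) (f : ∀ k, ι k) {p : ℕ}
    {z : S} (hz : z ∉ lowerUnion Z p) (n : ℕ) :
    ∀ a, a + n = m → p ≤ a → (∀ k, a ≤ k → k ≤ m → segDeg d f k m +ᵥ z ∈ lowerUnion Z (p + 1)) →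
      segDeg d f a m +ᵥ z ∉ lowerUnion Z p := by
  induction n with
  | zero =>
    intro a ha _ _
    obtain rfl : a = m := by omega
    rwa [segDeg_self, zero_vadd]
  | succ n ih =>
    intro a ha hpa hX
    have h₁ := ih (a + 1) (by omega) (by omega) fun k hk => hX k (by omega)
    have h₂ := hX (a + 1) (by omega) (by omega)
    have h₃ := segDeg_step (d := d) f ⟨a, by omega⟩ (c := m) (by simp; omega) z
    simp only at h₃
    rw [h₃]
    exact h.stable_high _ _ _ _ hpa h₂ h₁

/-- A path in the lower union of level `p + 1` that ends in the `p`-th stratum passes through it at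
step `p`. -/
theorem notMem_of_end_notMem (h : IsConvexDecomposition 𝒜 J d Z) (f : ∀ k, ι k) {p : ℕ}
    (hp : p ≤ m) {y : S} (hX : ∀ k ≤ m, segDeg d f k m +ᵥ y ∈ lowerUnion Z m)
    {a : ℕ} (hap : a ≤ p) (hend : segDeg d f a m +ᵥ y ∉ lowerUnion Z p) :
    segDeg d f p m +ᵥ y ∉ lowerUnion Z p := by
  intro hmem
  apply hend
  rw [← segDeg_vadd_segDeg_vadd f hap hp]
  refine h.segDeg_vadd_mem_lowerUnion f hp hmem (p - a) a (by omega) fun k _ hk => ?_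
  rw [segDeg_vadd_segDeg_vadd f hk hp]
  exact hX k (hk.trans hp)

theorem mem_span_segProd (h : IsConvexDecomposition 𝒜 J d Z) {a b : ℕ} {γ : Γ} {x : A}
    (hx : x ∈ segSub As a b) (hxγ : x ∈ 𝒜 γ) :
    x ∈ Submodule.span K ((fun f => segProd J f a b) '' {f | segDeg d f a b = γ}) := by
  rw [segSub_eq_span J h.one_mem] at hx
  exact mem_span_of_homogeneous 𝒜 (fun f => segProd_mem J 𝒜 h.homogeneous f a b) hxγ hx

theorem mem_span_segProd_zero (h : IsConvexDecomposition 𝒜 J d Z) {γ : Γ} {x : A}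
    (hxγ : x ∈ 𝒜 γ) :
    x ∈ Submodule.span K ((fun f => segProd J f 0 m) '' {f | segDeg d f 0 m = γ}) := by
  refine mem_span_of_homogeneous 𝒜 (fun f => segProd_mem J 𝒜 h.homogeneous f 0 m) hxγ ?_
  have h₁ := (prodBasis J h.bijective).mem_span x
  have h₂ : (⇑(prodBasis J h.bijective) : (∀ k, ι k) → A) = fun f => segProd J f 0 m :=
    funext (prodBasis_apply J h.bijective)
  rwa [h₂] at h₁

/-- The span of the products of basis elements whose path from `y` leaves the set `X`. -/
def exitSpan (J : ∀ i, Module.Basis (ι i) K (As i)) (d : ∀ i, ι i → Γ) (X : Set S) (y : S) :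
    Submodule K A :=
  Submodule.span K {x | ∃ f a, a ≤ m ∧ segDeg d f a m +ᵥ y ∉ X ∧ x = segProd J f 0 m}

theorem mul_mem_of_span {M : Submodule K A} {s : Set A} {c x : A}
    (hx : x ∈ Submodule.span K s) (hs : ∀ y ∈ s, c * y ∈ M) : c * x ∈ M :=
  (Submodule.span_le (p := M.comap (LinearMap.mulLeft K c))).2 hs hx

theorem mul_mem_of_span' {M : Submodule K A} {s : Set A} {c x : A}
    (hx : x ∈ Submodule.span K s) (hs : ∀ y ∈ s, y * c ∈ M) : x * c ∈ M :=
  (Submodule.span_le (p := M.comap (LinearMap.mulRight K c))).2 hs hx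

/-- Downward induction on the level `ℓ` outside of which the intermediate point lies. A path that
leaves the next larger lower union is bracketed anew at the exit point and handled by induction.
Otherwise the paths stay in `lowerUnion Z (p + 1)` and are in stratum `p` at the cutting point,
where the two high parts can be multiplied inside `A_p ⋯ A_m`. -/
theorem mul_mem_exitSpan_aux (h : IsConvexDecomposition 𝒜 J d Z) {q : ℕ} (hq : 0 < q)
    (hqm : q ≤ m) {y : S} (hy : y ∈ lowerUnion Z q) (n : ℕ) :
    ∀ ℓ, ℓ + n = m → q ≤ ℓ → ∀ (γ γ' : Γ), γ' +ᵥ y ∉ lowerUnion Z ℓ → ∀ c ∈ 𝒜 γ, ∀ c' ∈ 𝒜 γ',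
      c * c' ∈ exitSpan J d (lowerUnion Z q) y := by
  induction n with
  | zero =>
    rintro ℓ rfl - γ γ' hγ' c hc c' hc'
    refine Submodule.span_mono ?_ (h.mem_span_segProd_zero (SetLike.mul_mem_graded hc hc'))
    rintro _ ⟨f, hf, rfl⟩
    -- The exit occurs at the endpoint: if it were in `X`, convexity would put the intermediate
    -- point in `Y`.
    refine ⟨f, 0, Nat.zero_le _, fun hmem => hγ' ?_, rfl⟩
    rw [hf] at hmem
    exact h.convex γ γ' y (lowerUnion_mono Z hqm hy) (lowerUnion_mono Z hqm hmem)
  | succ n ih =>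
    intro p hpn hqp γ γ' hγ' c hc c' hc'
    have ih := ih (p + 1) (by omega) (by omega)
    have hpm : p < m := by omega
    refine mul_mem_of_span (h.mem_span_segProd_zero hc') ?_
    rintro _ ⟨f', hf', rfl⟩
    change c * segProd J f' 0 m ∈ _
    by_cases hpath : ∀ k ≤ m, segDeg d f' k m +ᵥ y ∈ lowerUnion Z (p + 1)
    swap
    · push Not at hpath
      obtain ⟨k, hk, hkX⟩ := hpath
      rw [← segProd_mul J f' (Nat.zero_le k) hk, ← mul_assoc]
      exact ih _ _ hkX _ (SetLike.mul_mem_graded hc (segProd_mem J 𝒜 h.homogeneous f' 0 k)) _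
        (segProd_mem J 𝒜 h.homogeneous f' k m)
    have hz : segDeg d f' p m +ᵥ y ∉ lowerUnion Z p :=
      h.notMem_of_end_notMem f' hpm.le
        (fun k hk => lowerUnion_mono Z hpm (hpath k hk)) (Nat.zero_le p) (by rwa [hf'])
    -- The low part of `f'` joins `c`, so that the new intermediate point is the one at step `p`.
    rw [← segProd_mul J f' (Nat.zero_le p) hpm.le, ← mul_assoc]
    refine mul_mem_of_span' (h.mem_span_segProd_zero
      (SetLike.mul_mem_graded hc (segProd_mem J 𝒜 h.homogeneous f' 0 p))) ?_
    rintro _ ⟨g, -, rfl⟩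
    change segProd J g 0 m * segProd J f' p m ∈ _
    by_cases hpath' : ∀ k, p ≤ k → k ≤ m →
        segDeg d g k m +ᵥ (segDeg d f' p m +ᵥ y) ∈ lowerUnion Z (p + 1)
    swap
    · push Not at hpath'
      obtain ⟨k, hpk, hk, hkX⟩ := hpath'
      rw [← segProd_mul J g (Nat.zero_le k) hk, mul_assoc]
      rw [← add_vadd] at hkX
      exact ih _ _ hkX _ (segProd_mem J 𝒜 h.homogeneous g 0 k) _
        (SetLike.mul_mem_graded (segProd_mem J 𝒜 h.homogeneous g k m)
          (segProd_mem J 𝒜 h.homogeneous f' p m))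
    have hz' := h.segDeg_vadd_notMem_lowerUnion g hz (m - p) p (by omega) le_rfl hpath'
    rw [← segProd_mul J g (Nat.zero_le p) hpm.le, mul_assoc]
    refine mul_mem_of_span (h.mem_span_segProd
      (h.mul_high p (by omega) hpm _ (segProd_mem_segSub J g p m) _ (segProd_mem_segSub J f' p m))
      (SetLike.mul_mem_graded (segProd_mem J 𝒜 h.homogeneous g p m)
        (segProd_mem J 𝒜 h.homogeneous f' p m))) ?_
    rintro _ ⟨f, hf, rfl⟩
    refine Submodule.subset_span ⟨merge p g f, p, hpm.le, ?_, segProd_mul_segProd J g f hpm.le⟩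
    rw [segDeg_merge_high d g f le_rfl, hf, add_vadd]
    exact fun hmem => hz' (lowerUnion_mono Z hqp hmem)

theorem mul_mem_exitSpan (h : IsConvexDecomposition 𝒜 J d Z) {q : ℕ} (hq : 0 < q)
    (hqm : q ≤ m) {y : S} (hy : y ∈ lowerUnion Z q) {γ γ' : Γ} (hγ' : γ' +ᵥ y ∉ lowerUnion Z q)
    {c c' : A} (hc : c ∈ 𝒜 γ) (hc' : c' ∈ 𝒜 γ') :
    c * c' ∈ exitSpan J d (lowerUnion Z q) y :=
  h.mul_mem_exitSpan_aux hq hqm hy (m - q) q (by omega) le_rfl γ γ' hγ' c hc c' hc'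

theorem coord_mul_eq_zero (h : IsConvexDecomposition 𝒜 J d Z) {q : ℕ} (hq : 0 < q)
    (hqm : q ≤ m) {y : S} {f : ∀ k, ι k}
    (hf : ∀ k ≤ m, segDeg d f k m +ᵥ y ∈ lowerUnion Z q) {γ γ' : Γ}
    (hγ' : γ' +ᵥ y ∉ lowerUnion Z q) {c c' : A} (hc : c ∈ 𝒜 γ) (hc' : c' ∈ 𝒜 γ') :
    (prodBasis J h.bijective).coord f (c * c') = 0 := by
  have hy : y ∈ lowerUnion Z q := by
    have := hf m le_rfl
    rwa [segDeg_self, zero_vadd] at this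
  have h₁ := h.mul_mem_exitSpan hq hqm hy hγ' hc hc'
  rw [← LinearMap.mem_ker]
  refine Submodule.span_le.2 ?_ h₁
  rintro _ ⟨f', a, ha, hfa, rfl⟩
  rw [SetLike.mem_coe, LinearMap.mem_ker, ← prodBasis_apply J h.bijective,
    Module.Basis.coord_apply, Module.Basis.repr_self, Finsupp.single_eq_of_ne]
  rintro rfl
  exact hfa (hf a ha)

end IsConvexDecomposition

end Paths

section CAlgebra

variable {K A Γ S : Type*} [Field K] [Ring A] [Algebra K A] [AddCommMonoid Γ] [DecidableEq Γ]
  (𝒜 : Γ → Submodule K A) [GradedAlgebra 𝒜] [AddAction Γ S]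

/-- The quotient map `C → C(X)`. -/
def toCAlg (X : Set S) : SkewProduct 𝒜 S →ₐ[K] CAlg 𝒜 X :=
  RingCon.mkₐ K _

theorem toCAlg_surjective (X : Set S) : Function.Surjective (toCAlg 𝒜 X) :=
  RingCon.mkₐ_surjective _

theorem toCAlg_eq_zero_iff {X : Set S} {x : SkewProduct 𝒜 S} :
    toCAlg 𝒜 X x = 0 ↔ x ∈ TwoSidedIdeal.span {mulChi 𝒜 1 Xᶜ} := by
  rw [← map_zero (toCAlg 𝒜 X), TwoSidedIdeal.mem_iff]
  exact RingCon.eq _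

/-- The class of `a χ_y`, as a linear map in `a`. -/
def pointMap (X : Set S) (y : S) : A →ₗ[K] CAlg 𝒜 X :=
  (toCAlg 𝒜 X).toLinearMap ∘ₗ (TensorProduct.mk K A (S → K)).flip (Set.indicator {y} 1)

theorem chi_eq_pointMap (X : Set S) (a : A) (y : S) :
    CAlg.chi 𝒜 X a {y} = pointMap 𝒜 X y a := rfl

theorem mulChi_mul_mulChi {γ : Γ} (a : A) (V : Set S) {a' : A} (ha' : a' ∈ 𝒜 γ) (W : Set S) :
    mulChi 𝒜 a V * mulChi 𝒜 a' W = mulChi 𝒜 (a * a') {s | γ +ᵥ s ∈ V ∧ s ∈ W} := by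
  classical
  unfold mulChi
  rw [SkewProduct.tmul_mul_tmul 𝒜 _ _ ha']
  congr 1
  funext s
  by_cases h₁ : γ +ᵥ s ∈ V <;> by_cases h₂ : s ∈ W <;> simp [Set.indicator, h₁, h₂]

theorem mulChi_empty (a : A) : mulChi 𝒜 a (∅ : Set S) = 0 := by
  unfold mulChi SkewProduct.tmul
  rw [Set.indicator_empty]
  exact TensorProduct.tmul_zero _ _

theorem pointMap_mul {X : Set S} {γ : Γ} (a : A) (z : S) {a' : A} (ha' : a' ∈ 𝒜 γ) {y : S}
    (hz : γ +ᵥ y = z) : pointMap 𝒜 X z a * pointMap 𝒜 X y a' = pointMap 𝒜 X y (a * a') := by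
  change toCAlg 𝒜 X (mulChi 𝒜 a {z}) * toCAlg 𝒜 X (mulChi 𝒜 a' {y})
    = toCAlg 𝒜 X (mulChi 𝒜 (a * a') {y})
  rw [← map_mul, mulChi_mul_mulChi 𝒜 _ _ ha']
  congr 2
  ext s
  simp only [Set.mem_singleton_iff, Set.mem_ofPred_eq, and_iff_right_iff_imp]
  rintro rfl
  exact hz

theorem pointMap_mul_of_ne {X : Set S} {γ : Γ} (a : A) (z : S) {a' : A} (ha' : a' ∈ 𝒜 γ) {y : S}
    (hz : γ +ᵥ y ≠ z) : pointMap 𝒜 X z a * pointMap 𝒜 X y a' = 0 := by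
  change toCAlg 𝒜 X (mulChi 𝒜 a {z}) * toCAlg 𝒜 X (mulChi 𝒜 a' {y}) = 0
  rw [← map_mul, mulChi_mul_mulChi 𝒜 _ _ ha', ← map_zero (toCAlg 𝒜 X), ← mulChi_empty 𝒜 (a * a')]
  congr 2
  ext s
  simp only [Set.mem_singleton_iff, Set.mem_ofPred_eq, Set.mem_empty_iff_false, iff_false, not_and]
  rintro h rfl
  exact hz h

theorem toCAlg_compl (X : Set S) : toCAlg 𝒜 X (mulChi 𝒜 1 Xᶜ) = 0 :=
  (toCAlg_eq_zero_iff 𝒜).2 (TwoSidedIdeal.subset_span rfl)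

theorem pointMap_eq_zero {X : Set S} {y : S} {γ : Γ} {a : A} (ha : a ∈ 𝒜 γ) (hy : γ +ᵥ y ∉ X) :
    pointMap 𝒜 X y a = 0 := by
  have h : mulChi 𝒜 a {y} = mulChi 𝒜 1 Xᶜ * mulChi 𝒜 a {y} := by
    rw [mulChi_mul_mulChi 𝒜 _ _ ha, one_mul]
    congr 1
    ext s
    simp only [Set.mem_singleton_iff, Set.mem_ofPred_eq, iff_and_self]
    rintro rfl
    exact hy
  change toCAlg 𝒜 X (mulChi 𝒜 a {y}) = 0
  rw [h, map_mul, toCAlg_compl, zero_mul]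

theorem mulChi_add_of_disjoint (a : A) {V W : Set S} (h : Disjoint V W) :
    mulChi 𝒜 a (V ∪ W) = mulChi 𝒜 a V + mulChi 𝒜 a W := by
  unfold mulChi SkewProduct.tmul
  rw [Set.indicator_union_of_disjoint h]
  exact TensorProduct.tmul_add _ _ _

theorem toCAlg_mulChi_finset (X : Set S) (F : Finset S) (a : A) :
    toCAlg 𝒜 X (mulChi 𝒜 a (F : Set S)) = ∑ y ∈ F, pointMap 𝒜 X y a := by
  classical
  induction F using Finset.induction_on with
  | empty => rw [Finset.coe_empty, mulChi_empty, map_zero, Finset.sum_empty]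
  | insert y F hy ih =>
    rw [Finset.sum_insert hy, ← ih, Finset.coe_insert, Set.insert_eq,
      mulChi_add_of_disjoint 𝒜 a (by simpa using hy), map_add]
    rfl

theorem mulChi_univ : mulChi 𝒜 1 (Set.univ : Set S) = 1 := by
  unfold mulChi
  rw [Set.indicator_univ]
  rfl

theorem one_eq_sum_pointMap {X : Set S} (hX : X.Finite) :
    (1 : CAlg 𝒜 X) = ∑ y ∈ hX.toFinset, pointMap 𝒜 X y 1 := by
  rw [← toCAlg_mulChi_finset, ← map_one (toCAlg 𝒜 X), ← mulChi_univ,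
    ← Set.union_compl_self X, mulChi_add_of_disjoint 𝒜 1 disjoint_compl_right, map_add,
    toCAlg_compl, add_zero, Set.Finite.coe_toFinset]

theorem toCAlg_tmul_mul_pointMap (X : Set S) (a : A) (b : S → K) (y : S) :
    toCAlg 𝒜 X (SkewProduct.tmul 𝒜 S a b) * pointMap 𝒜 X y 1 = b y • pointMap 𝒜 X y a := by
  classical
  change toCAlg 𝒜 X (SkewProduct.tmul 𝒜 S a b) * toCAlg 𝒜 X (mulChi 𝒜 1 {y})
    = b y • toCAlg 𝒜 X (mulChi 𝒜 a {y})
  rw [← map_mul, ← map_smul]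
  unfold mulChi
  rw [SkewProduct.tmul_mul_tmul 𝒜 _ _ (SetLike.one_mem_graded 𝒜), mul_one]
  congr 1
  refine Eq.trans ?_ (TensorProduct.tmul_smul (b y) a (Set.indicator {y} (1 : S → K)))
  change SkewProduct.tmul 𝒜 S _ _ = SkewProduct.tmul 𝒜 S _ _
  congr 1
  funext s
  by_cases hs : s = y
  · subst hs
    simp
  · simp [hs]

theorem mem_span_pointMap {X : Set S} (hX : X.Finite) (c : CAlg 𝒜 X) :
    c ∈ Submodule.span K {x | ∃ a, ∃ y ∈ X, x = pointMap 𝒜 X y a} := by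
  obtain ⟨c, rfl⟩ := toCAlg_surjective 𝒜 X c
  induction c using SkewProduct.induction 𝒜 with
  | h0 => simp
  | hadd x y hx hy =>
    rw [map_add]
    exact add_mem hx hy
  | h γ a _ b =>
    rw [← mul_one (toCAlg 𝒜 X _), one_eq_sum_pointMap 𝒜 hX, Finset.mul_sum]
    refine sum_mem fun y hy => ?_
    rw [toCAlg_tmul_mul_pointMap]
    exact Submodule.smul_mem _ _ (Submodule.subset_span ⟨a, y, hX.mem_toFinset.1 hy, rfl⟩)

theorem idem_eq_sum {X V : Set S} (hX : X.Finite) :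
    CAlg.idem 𝒜 X V = ∑ y ∈ (hX.subset (Set.inter_subset_left (t := V))).toFinset,
      pointMap 𝒜 X y 1 := by
  have h : mulChi 𝒜 1 V = mulChi 𝒜 1 (X ∩ V) + mulChi 𝒜 1 V * mulChi 𝒜 1 Xᶜ := by
    rw [mulChi_mul_mulChi 𝒜 _ _ (SetLike.one_mem_graded 𝒜), one_mul, ← mulChi_add_of_disjoint]
    · congr 1
      ext s
      by_cases hs : s ∈ X <;> simp [hs]
    · rw [Set.disjoint_left]
      rintro s ⟨hs, -⟩ ⟨-, hs'⟩
      exact hs' hs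
  rw [← toCAlg_mulChi_finset, Set.Finite.coe_toFinset]
  change toCAlg 𝒜 X (mulChi 𝒜 1 V) = _
  rw [h, map_add, map_mul, toCAlg_compl, mul_zero, add_zero]

end CAlgebra

section CoordinateFunctional

variable {K A Γ S : Type*} [Field K] [Ring A] [Algebra K A] [AddCommMonoid Γ] [DecidableEq Γ]
  [AddAction Γ S] {m : ℕ} {As : Fin m → Submodule K A} {ι : Fin m → Type*}
  {𝒜 : Γ → Submodule K A} [GradedAlgebra 𝒜] {J : ∀ i, Module.Basis (ι i) K (As i)}
  {d : ∀ i, ι i → Γ} {Z : Fin m → Set S}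

/-- The functional `a ⊗ b ↦ φ a * b y` on the skew product. -/
def evalFunctional (𝒜 : Γ → Submodule K A) [GradedAlgebra 𝒜] (φ : A →ₗ[K] K) (y : S) :
    SkewProduct 𝒜 S →ₗ[K] K :=
  TensorProduct.lift ((LinearMap.mul K K).compl₁₂ φ (LinearMap.proj y))

theorem evalFunctional_tmul (φ : A →ₗ[K] K) (y : S) (a : A) (b : S → K) :
    evalFunctional 𝒜 φ y (SkewProduct.tmul 𝒜 S a b) = φ a * b y := rfl

namespace IsConvexDecomposition

theorem evalFunctional_eq_zero (h : IsConvexDecomposition 𝒜 J d Z) {q : ℕ} (hq : 0 < q)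
    (hqm : q ≤ m) {y : S} {f : ∀ k, ι k}
    (hf : ∀ k ≤ m, segDeg d f k m +ᵥ y ∈ lowerUnion Z q) {x : SkewProduct 𝒜 S}
    (hx : x ∈ TwoSidedIdeal.span {mulChi 𝒜 1 (lowerUnion Z q)ᶜ}) :
    evalFunctional 𝒜 ((prodBasis J h.bijective).coord f) y x = 0 := by
  classical
  rw [mem_span_singleton_iff (K := K)] at hx
  rw [← LinearMap.mem_ker]
  refine Submodule.span_le.2 ?_ hx
  rintro _ ⟨u, v, rfl⟩
  rw [SetLike.mem_coe, LinearMap.mem_ker]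
  induction u using SkewProduct.induction 𝒜 with
  | h0 => rw [zero_mul, zero_mul, map_zero]
  | hadd u u' hu hu' => rw [add_mul, add_mul, map_add, hu, hu', add_zero]
  | h γ a ha b =>
  induction v using SkewProduct.induction 𝒜 with
  | h0 => rw [mul_zero, map_zero]
  | hadd v v' hv hv' => rw [mul_add, map_add, hv, hv', add_zero]
  | h γ' a' ha' b' =>
  rw [mulChi, SkewProduct.tmul_mul_tmul 𝒜 _ _ (SetLike.one_mem_graded 𝒜),
    SkewProduct.tmul_mul_tmul 𝒜 _ _ ha', evalFunctional_tmul, mul_one]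
  by_cases hy : γ' +ᵥ y ∈ lowerUnion Z q
  · simp [hy]
  · rw [h.coord_mul_eq_zero hq hqm hf hy ha ha', zero_mul]

theorem linearIndependent_basisElement (h : IsConvexDecomposition 𝒜 J d Z) {q : ℕ} (hq : 0 < q)
    (hqm : q ≤ m) {X : Type*} (v : X → (∀ k, ι k) × S) (hv : Function.Injective v)
    (hf : ∀ x, ∀ k ≤ m, segDeg d (v x).1 k m +ᵥ (v x).2 ∈ lowerUnion Z q) :
    LinearIndependent K
      fun x => pointMap 𝒜 (lowerUnion Z q) (v x).2 (segProd J (v x).1 0 m) := by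
  classical
  rw [linearIndependent_iff']
  intro s g hg x hx
  have h₁ : toCAlg 𝒜 (lowerUnion Z q)
      (∑ x ∈ s, g x • mulChi 𝒜 (segProd J (v x).1 0 m) {(v x).2}) = 0 := by
    rw [← hg, map_sum]
    exact Finset.sum_congr rfl fun x _ => map_smul _ _ _
  rw [toCAlg_eq_zero_iff] at h₁
  have h₂ := h.evalFunctional_eq_zero hq hqm (hf x) h₁
  rw [map_sum, Finset.sum_eq_single x] at h₂
  · rw [map_smul, mulChi, evalFunctional_tmul, ← prodBasis_apply J h.bijective] at h₂
    simpa using h₂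
  · intro x' _ hne
    rw [map_smul, mulChi, evalFunctional_tmul, ← prodBasis_apply J h.bijective,
      Module.Basis.coord_apply, Module.Basis.repr_self]
    by_cases hf' : (v x').1 = (v x).1
    · have : (v x).2 ≠ (v x').2 := fun hy => hne (hv (Prod.ext hf' hy.symm))
      simp [this]
    · rw [Finsupp.single_eq_of_ne (Ne.symm hf'), zero_mul, smul_zero]
  · exact fun hx' => (hx' hx).elim

theorem pointMap_segProd_eq_zero (h : IsConvexDecomposition 𝒜 J d Z) {X : Set S} {y : S}
    {f : ∀ k, ι k} {a b c : ℕ} (hab : a ≤ b) (hbc : b ≤ c) (hk : segDeg d f b c +ᵥ y ∉ X) :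
    pointMap 𝒜 X y (segProd J f a c) = 0 := by
  rw [← segProd_mul J f hab hbc,
    ← pointMap_mul 𝒜 _ _ (segProd_mem J 𝒜 h.homogeneous f b c) rfl,
    pointMap_eq_zero 𝒜 (segProd_mem J 𝒜 h.homogeneous f b c) hk, mul_zero]

theorem mem_span_basisElement (h : IsConvexDecomposition 𝒜 J d Z) {X : Set S}
    (hX : X.Finite) (c : CAlg 𝒜 X) :
    c ∈ Submodule.span K {x | ∃ (f : ∀ k, ι k) (y : S), (∀ k ≤ m, segDeg d f k m +ᵥ y ∈ X) ∧
      x = pointMap 𝒜 X y (segProd J f 0 m)} := by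
  refine Submodule.span_le.2 ?_ (mem_span_pointMap 𝒜 hX c)
  rintro _ ⟨a, y, hy, rfl⟩
  have h₁ := (prodBasis J h.bijective).mem_span a
  rw [SetLike.mem_coe, ← Submodule.mem_comap]
  refine Submodule.span_le.2 ?_ h₁
  rintro _ ⟨f, rfl⟩
  rw [SetLike.mem_coe, Submodule.mem_comap, prodBasis_apply]
  by_cases hf : ∀ k ≤ m, segDeg d f k m +ᵥ y ∈ X
  · exact Submodule.subset_span ⟨f, y, hf, rfl⟩
  · push Not at hf
    obtain ⟨k, hk, hkX⟩ := hf
    rw [h.pointMap_segProd_eq_zero (Nat.zero_le k) hk hkX]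
    exact zero_mem _

end IsConvexDecomposition

end CoordinateFunctional

section ConcreteFactorization

variable {K A Γ S : Type*} [Field K] [Ring A] [Algebra K A] [AddCommMonoid Γ] [DecidableEq Γ]
  [AddAction Γ S] {m : ℕ} {As : Fin m → Submodule K A} {ι : Fin m → Type*}
  {𝒜 : Γ → Submodule K A} [GradedAlgebra 𝒜] {J : ∀ i, Module.Basis (ι i) K (As i)}
  {d : ∀ i, ι i → Γ} {Z : Fin m → Set S}

/-- The `p`-th stratum. -/
abbrev stratum (Z : Fin m → Set S) (p : ℕ) : Set S := lowerUnion Z (p + 1) \ lowerUnion Z p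

/-- The products of basis elements with indices below `p`, with a source in the `p`-th stratum. -/
abbrev LowIndex (J : ∀ i, Module.Basis (ι i) K (As i)) (d : ∀ i, ι i → Γ) (Z : Fin m → Set S)
    (p : ℕ) : Type _ :=
  {x : A × stratum Z p // ∃ f, x.1 = segProd J f 0 p ∧
    ∀ k ≤ p, segDeg d f k p +ᵥ (x.2 : S) ∈ lowerUnion Z (p + 1)}

/-- The products of basis elements with indices from `p` on, with a target in the `p`-th stratum. -/
abbrev HighIndex (J : ∀ i, Module.Basis (ι i) K (As i)) (d : ∀ i, ι i → Γ) (Z : Fin m → Set S)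
    (p : ℕ) : Type _ :=
  {x : A × S × stratum Z p // ∃ g, x.1 = segProd J g p m ∧
    (∀ k, p ≤ k → k ≤ m → segDeg d g k m +ᵥ x.2.1 ∈ lowerUnion Z (p + 1)) ∧
    segDeg d g p m +ᵥ x.2.1 = x.2.2}

variable (𝒜 J d Z) in
/-- The element of `C(X)` given by a product of basis elements with indices below `p`. -/
def lowElement (p : ℕ) (b : LowIndex J d Z p) : CAlg 𝒜 (lowerUnion Z (p + 1)) :=
  pointMap 𝒜 _ (b.1.2 : S) b.1.1

variable (𝒜 J d Z) in
/-- The element of `C(X)` given by a product of basis elements with indices from `p` on. -/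
def highElement (p : ℕ) (c : HighIndex J d Z p) : CAlg 𝒜 (lowerUnion Z (p + 1)) :=
  pointMap 𝒜 _ c.1.2.1 c.1.1

namespace IsConvexDecomposition

theorem exists_factors (h : IsConvexDecomposition 𝒜 J d Z) {p : ℕ} (hpm : p < m) {f : ∀ k, ι k}
    {y : S} (hf : ∀ k ≤ m, segDeg d f k m +ᵥ y ∈ lowerUnion Z (p + 1))
    (hz : segDeg d f p m +ᵥ y ∉ lowerUnion Z p) :
    ∃ (b : LowIndex J d Z p) (c : HighIndex J d Z p), b.1.2 = c.1.2.2 ∧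
      lowElement 𝒜 J d Z p b = pointMap 𝒜 _ (segDeg d f p m +ᵥ y) (segProd J f 0 p) ∧
      highElement 𝒜 J d Z p c = pointMap 𝒜 _ y (segProd J f p m) ∧
      pointMap 𝒜 _ y (segProd J f 0 m) = lowElement 𝒜 J d Z p b * highElement 𝒜 J d Z p c := by
  refine ⟨⟨(segProd J f 0 p, ⟨segDeg d f p m +ᵥ y, hf p hpm.le, hz⟩), f, rfl, fun k hk => ?_⟩,
    ⟨(segProd J f p m, y, ⟨segDeg d f p m +ᵥ y, hf p hpm.le, hz⟩), f, rfl, fun k _ hk => hf k hk,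
      rfl⟩, rfl, rfl, rfl, ?_⟩
  · change segDeg d f k p +ᵥ (segDeg d f p m +ᵥ y) ∈ _
    rw [segDeg_vadd_segDeg_vadd f hk hpm.le]
    exact hf k (hk.trans hpm.le)
  · rw [← segProd_mul J f (Nat.zero_le p) hpm.le]
    exact (pointMap_mul 𝒜 _ _ (segProd_mem J 𝒜 h.homogeneous f p m) rfl).symm

theorem isFactorization (h : IsConvexDecomposition 𝒜 J d Z) {p : ℕ} (hp : 0 < p) (hpm : p < m) :
    IsFactorization K (fun z : stratum Z p => pointMap 𝒜 (lowerUnion Z (p + 1)) (z : S) 1)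
      (lowElement 𝒜 J d Z p) (fun b => b.1.2) (highElement 𝒜 J d Z p) (fun c => c.1.2.2) where
  idem z := by
    rw [pointMap_mul 𝒜 _ _ (SetLike.one_mem_graded 𝒜) (zero_vadd Γ (z : S)), one_mul]
  orth z z' hz := by
    rw [pointMap_mul_of_ne 𝒜 _ _ (SetLike.one_mem_graded 𝒜)]
    rw [zero_vadd]
    exact fun hz' => hz (Subtype.ext hz'.symm)
  l_mul b := by
    rw [lowElement, pointMap_mul 𝒜 _ _ (SetLike.one_mem_graded 𝒜) (zero_vadd Γ _), mul_one]
  mul_r c := by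
    obtain ⟨⟨a, y, z⟩, g, ha, -, hz⟩ := c
    simp only at ha hz
    subst ha
    rw [highElement, pointMap_mul 𝒜 _ _ (segProd_mem J 𝒜 h.homogeneous g p m) hz, one_mul]
  linIndep := by
    choose f hf₁ hf₂ using fun b : LowIndex J d Z p => b.2
    choose g hg₁ hg₂ hg₃ using fun c : HighIndex J d Z p => c.2
    have h₁ := h.linearIndependent_basisElement (q := p + 1) (by omega) (by omega)
      (X := {x : LowIndex J d Z p × HighIndex J d Z p | x.1.1.2 = x.2.1.2.2})
      (fun x => (merge p (f x.1.1) (g x.1.2), x.1.2.1.2.1)) (by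
        rintro ⟨⟨b, c⟩, hbc⟩ ⟨⟨b', c'⟩, hbc'⟩ heq
        simp only [Set.mem_ofPred_eq] at hbc hbc'
        simp only [Prod.mk.injEq] at heq
        obtain ⟨h₁, h₂⟩ := heq
        have hg : segProd J (g c) p m = segProd J (g c') p m := by
          rw [← segProd_merge_high J (f b) (g c) le_rfl, h₁, segProd_merge_high J _ _ le_rfl]
        have hf : segProd J (f b) 0 p = segProd J (f b') 0 p := by
          rw [← segProd_merge_low J (f b) (g c) le_rfl, h₁, segProd_merge_low J _ _ le_rfl]
        have hd : segDeg d (g c) p m = segDeg d (g c') p m := by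
          rw [← segDeg_merge_high d (f b) (g c) le_rfl, h₁, segDeg_merge_high d _ _ le_rfl]
        have hz : c.1.2.2 = c'.1.2.2 := by
          apply Subtype.ext
          rw [← hg₃ c, ← hg₃ c', hd, h₂]
        have hc : c = c' := Subtype.ext (Prod.ext (by rw [hg₁ c, hg₁ c', hg]) (Prod.ext h₂ hz))
        have hb : b = b' := Subtype.ext (Prod.ext (by rw [hf₁ b, hf₁ b', hf])
          (by rw [hbc, hbc', hz]))
        subst hb hc
        rfl) (by
        rintro ⟨⟨b, c⟩, hbc⟩ k hk
        simp only [Set.mem_ofPred_eq] at hbc ⊢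
        rcases le_total p k with hpk | hkp
        · rw [segDeg_merge_high d _ _ hpk]
          exact hg₂ c k hpk hk
        · rw [← segDeg_add d _ hkp hpm.le, segDeg_merge_high d _ _ le_rfl,
            segDeg_merge_low d _ _ le_rfl, add_vadd, hg₃ c, ← hbc]
          exact hf₂ b k hkp)
    have h₂ : (fun x : {x : LowIndex J d Z p × HighIndex J d Z p | x.1.1.2 = x.2.1.2.2} =>
        lowElement 𝒜 J d Z p x.1.1 * highElement 𝒜 J d Z p x.1.2) = fun x =>
          pointMap 𝒜 (lowerUnion Z (p + 1)) x.1.2.1.2.1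
            (segProd J (merge p (f x.1.1) (g x.1.2)) 0 m) := by
      funext x
      obtain ⟨⟨b, c⟩, hbc⟩ := x
      simp only [Set.mem_ofPred_eq] at hbc
      have h₂ := hg₁ c
      have h₃ := segProd_mem J 𝒜 h.homogeneous (g c) p m
      rw [← h₂] at h₃
      change pointMap 𝒜 _ (b.1.2 : S) b.1.1 * pointMap 𝒜 _ c.1.2.1 c.1.1 = _
      rw [pointMap_mul 𝒜 _ _ h₃ (by rw [hg₃ c, hbc]), ← segProd_mul_segProd J _ _ hpm.le,
        ← hf₁ b, h₂]
    change LinearIndependent K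
      (fun x : {x : LowIndex J d Z p × HighIndex J d Z p | x.1.1.2 = x.2.1.2.2} =>
        lowElement 𝒜 J d Z p x.1.1 * highElement 𝒜 J d Z p x.1.2)
    rw [h₂]
    exact h₁
  mul_chi_mem x z := by
    refine mul_mem_of_span' (h.mem_span_basisElement (h.finite.subset (lowerUnion_mono Z hpm)) x) ?_
    rintro _ ⟨f, y, hf, rfl⟩
    by_cases hy : y = z
    · subst hy
      have hz := h.segDeg_vadd_notMem_lowerUnion f z.2.2 (m - p) p (by omega) le_rfl
        fun k _ hk => hf k hk
      obtain ⟨b, c, hbc, -, hc, hprod⟩ := h.exists_factors hpm hf hz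
      rw [pointMap_mul 𝒜 _ _ (SetLike.one_mem_graded 𝒜) (zero_vadd Γ _), mul_one, hprod]
      refine Submodule.subset_span ⟨b, c, hbc, ?_, rfl⟩
      rw [hc, pointMap_mul 𝒜 _ _ (SetLike.one_mem_graded 𝒜) (zero_vadd Γ _), mul_one]
    · rw [pointMap_mul_of_ne 𝒜 _ _ (SetLike.one_mem_graded 𝒜)]
      · exact zero_mem _
      · rw [zero_vadd]
        exact fun hy' => hy hy'.symm
  chi_mul_mem x z := by
    refine mul_mem_of_span (h.mem_span_basisElement (h.finite.subset (lowerUnion_mono Z hpm)) x) ?_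
    rintro _ ⟨f, y, hf, rfl⟩
    have hmem := segProd_mem J 𝒜 h.homogeneous f 0 m
    by_cases hy : segDeg d f 0 m +ᵥ y = z
    · have hz := h.notMem_of_end_notMem f hpm.le (fun k hk => lowerUnion_mono Z hpm (hf k hk))
        (Nat.zero_le p) (by rw [hy]; exact z.2.2)
      obtain ⟨b, c, hbc, hb, hc, hprod⟩ := h.exists_factors hpm hf hz
      rw [pointMap_mul 𝒜 _ _ hmem hy, one_mul, hprod]
      refine Submodule.subset_span ⟨b, c, hbc, ?_, rfl⟩
      rw [hb, pointMap_mul 𝒜 _ _ (segProd_mem J 𝒜 h.homogeneous f 0 p), one_mul]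
      rw [segDeg_vadd_segDeg_vadd f (Nat.zero_le p) hpm.le, hy]
    · rw [pointMap_mul_of_ne 𝒜 _ _ hmem hy]
      exact zero_mem _
  r_mul_r c c' := by
    obtain ⟨⟨a, y, z⟩, g, ha, -, hz⟩ := c
    obtain ⟨⟨a', y', z'⟩, g', ha', -, hz'⟩ := c'
    simp only at ha hz ha' hz'
    subst ha ha'
    have hmem := segProd_mem J 𝒜 h.homogeneous g p m
    have hmem' := segProd_mem J 𝒜 h.homogeneous g' p m
    by_cases hy : segDeg d g' p m +ᵥ y' = y
    · rw [highElement, highElement, pointMap_mul 𝒜 _ _ hmem' hy, ← Submodule.mem_comap]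
      refine Submodule.span_le.2 ?_ (h.mem_span_segProd
        (h.mul_high p hp hpm _ (segProd_mem_segSub J g p m) _ (segProd_mem_segSub J g' p m))
        (SetLike.mul_mem_graded hmem hmem'))
      rintro _ ⟨f, hf, rfl⟩
      rw [SetLike.mem_coe, Submodule.mem_comap]
      simp only
      by_cases hpath : ∀ k, p ≤ k → k ≤ m → segDeg d f k m +ᵥ y' ∈ lowerUnion Z (p + 1)
      · refine Submodule.subset_span ⟨⟨(segProd J f p m, y', z), f, rfl, hpath, ?_⟩, rfl, rfl⟩
        simp only
        rw [hf, add_vadd, hy, hz]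
      · push Not at hpath
        obtain ⟨k, hpk, hk, hkX⟩ := hpath
        rw [h.pointMap_segProd_eq_zero hpk hk hkX]
        exact zero_mem _
    · rw [highElement, highElement, pointMap_mul_of_ne 𝒜 _ _ hmem' hy]
      exact zero_mem _
  l_mul_l b b' := by
    obtain ⟨⟨a, z⟩, f, ha, -⟩ := b
    obtain ⟨⟨a', z'⟩, f', ha', -⟩ := b'
    simp only at ha ha'
    subst ha ha'
    have hmem := segProd_mem J 𝒜 h.homogeneous f 0 p
    have hmem' := segProd_mem J 𝒜 h.homogeneous f' 0 p
    by_cases hy : segDeg d f' 0 p +ᵥ (z' : S) = z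
    · rw [lowElement, lowElement, pointMap_mul 𝒜 _ _ hmem' hy, ← Submodule.mem_comap]
      refine Submodule.span_le.2 ?_ (h.mem_span_segProd
        (h.mul_low p hp hpm _ (segProd_mem_segSub J f 0 p) _ (segProd_mem_segSub J f' 0 p))
        (SetLike.mul_mem_graded hmem hmem'))
      rintro _ ⟨g, hg, rfl⟩
      rw [SetLike.mem_coe, Submodule.mem_comap]
      simp only
      by_cases hpath : ∀ k ≤ p, segDeg d g k p +ᵥ (z' : S) ∈ lowerUnion Z (p + 1)
      · exact Submodule.subset_span ⟨⟨(segProd J g 0 p, z'), g, rfl, hpath⟩, rfl, rfl⟩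
      · push Not at hpath
        obtain ⟨k, hk, hkX⟩ := hpath
        rw [h.pointMap_segProd_eq_zero (Nat.zero_le k) hk hkX]
        exact zero_mem _
    · rw [lowElement, lowElement, pointMap_mul_of_ne 𝒜 _ _ hmem' hy]
      exact zero_mem _

theorem finite_stratum (h : IsConvexDecomposition 𝒜 J d Z) {p : ℕ} (hpm : p < m) :
    (stratum Z p).Finite :=
  (h.finite.subset (lowerUnion_mono Z hpm)).subset Set.sdiff_subset

theorem idem_eq_sum_stratum (h : IsConvexDecomposition 𝒜 J d Z) {p : ℕ} (hpm : p < m)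
    [Fintype (stratum Z p)] :
    CAlg.idem 𝒜 (lowerUnion Z (p + 1)) (lowerUnion Z p)ᶜ
      = ∑ z : stratum Z p, pointMap 𝒜 (lowerUnion Z (p + 1)) (z : S) 1 := by
  rw [idem_eq_sum 𝒜 (h.finite.subset (lowerUnion_mono Z hpm))]
  exact Finset.sum_subtype _ (fun x => by simp [stratum]) _

end IsConvexDecomposition

end ConcreteFactorization

section Chain

open CategoryTheory Abelian

variable {K A Γ S : Type*} [Field K] [Ring A] [Algebra K A] [AddCommMonoid Γ] [DecidableEq Γ]
  (𝒜 : Γ → Submodule K A) [GradedAlgebra 𝒜] [AddAction Γ S]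

theorem span_mulChi_compl_le {X X' : Set S} (hX : X' ⊆ X) :
    TwoSidedIdeal.span {mulChi 𝒜 1 Xᶜ} ≤ TwoSidedIdeal.span {mulChi 𝒜 1 X'ᶜ} := by
  rw [TwoSidedIdeal.span_le]
  rintro _ rfl
  have h : mulChi 𝒜 1 Xᶜ = mulChi 𝒜 1 Xᶜ * mulChi 𝒜 1 X'ᶜ := by
    rw [mulChi_mul_mulChi 𝒜 _ _ (SetLike.one_mem_graded 𝒜), one_mul]
    congr 1
    ext s
    simp only [Set.mem_compl_iff, zero_vadd, Set.mem_ofPred_eq, iff_self_and]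
    exact fun hs hs' => hs (hX hs')
  rw [SetLike.mem_coe, h]
  exact TwoSidedIdeal.mul_mem_left _ _ _ (TwoSidedIdeal.subset_span rfl)

/-- The projection `C(X) → C(X')` for `X' ⊆ X`. -/
def restrictMap {X X' : Set S} (hX : X' ⊆ X) : CAlg 𝒜 X →ₐ[K] CAlg 𝒜 X' :=
  RingCon.factorₐ K (TwoSidedIdeal.ringCon_le_iff.1 (span_mulChi_compl_le 𝒜 hX))

theorem restrictMap_toCAlg {X X' : Set S} (hX : X' ⊆ X) (x : SkewProduct 𝒜 S) :
    restrictMap 𝒜 hX (toCAlg 𝒜 X x) = toCAlg 𝒜 X' x := rfl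

theorem restrictMap_surjective {X X' : Set S} (hX : X' ⊆ X) :
    Function.Surjective (restrictMap 𝒜 hX) := by
  intro x
  obtain ⟨x, rfl⟩ := toCAlg_surjective 𝒜 X' x
  exact ⟨_, restrictMap_toCAlg 𝒜 hX x⟩

theorem restrictMap_eq_zero_iff {X X' : Set S} (hX : X' ⊆ X) (x : CAlg 𝒜 X) :
    restrictMap 𝒜 hX x = 0 ↔ x ∈ TwoSidedIdeal.span {CAlg.idem 𝒜 X X'ᶜ} := by
  rw [mem_span_singleton_iff (K := K)]
  constructor
  · intro hx
    obtain ⟨x, rfl⟩ := toCAlg_surjective 𝒜 X x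
    rw [restrictMap_toCAlg, toCAlg_eq_zero_iff, mem_span_singleton_iff (K := K)] at hx
    refine (Submodule.span_le (p := Submodule.comap (toCAlg 𝒜 X).toLinearMap
      (Submodule.span K {y | ∃ a b, y = a * CAlg.idem 𝒜 X X'ᶜ * b}))).2 ?_ hx
    rintro _ ⟨u, v, rfl⟩
    refine Submodule.subset_span ⟨toCAlg 𝒜 X u, toCAlg 𝒜 X v, ?_⟩
    change toCAlg 𝒜 X (u * mulChi 𝒜 1 X'ᶜ * v) = _
    rw [map_mul, map_mul]
    rfl
  · intro hx
    change x ∈ LinearMap.ker (restrictMap 𝒜 hX).toLinearMap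
    refine Submodule.span_le.2 ?_ hx
    rintro _ ⟨u, v, rfl⟩
    change restrictMap 𝒜 hX (u * CAlg.idem 𝒜 X X'ᶜ * v) = 0
    have h : restrictMap 𝒜 hX (CAlg.idem 𝒜 X X'ᶜ) = 0 := toCAlg_compl 𝒜 X'
    rw [map_mul, map_mul, h, mul_zero, zero_mul]

/-- The algebra `C(X')` as a module over `C(X)`, for `X' ⊆ X`. -/
abbrev restrictModule {X X' : Set S} (hX : X' ⊆ X) : Module (CAlg 𝒜 X) (CAlg 𝒜 X') :=
  Module.compHom _ (restrictMap 𝒜 hX).toRingHom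

variable {𝒜} {m : ℕ} {As : Fin m → Submodule K A} {ι : Fin m → Type*}
  {J : ∀ i, Module.Basis (ι i) K (As i)} {d : ∀ i, ι i → Γ} {Z : Fin m → Set S}

theorem IsConvexDecomposition.subsingleton_ext (h : IsConvexDecomposition 𝒜 J d Z) {q n : ℕ}
    (hq : 0 < q) (hnm : n ≤ m) (N : ModuleCat (CAlg 𝒜 (lowerUnion Z n)))
    (hN : ∀ x ∈ TwoSidedIdeal.span {CAlg.idem 𝒜 (lowerUnion Z n) (lowerUnion Z q)ᶜ},
      ∀ v : N, x • v = 0) (j : ℕ) :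
    ∀ k, (hkn : k ≤ n) → k + j = n → q ≤ k → ∀ i, Subsingleton (Ext
      (@ModuleCat.of (CAlg 𝒜 (lowerUnion Z n)) _ (CAlg 𝒜 (lowerUnion Z k)) _
        (restrictModule 𝒜 (lowerUnion_mono Z hkn))) N (i + 1)) := by
  induction j with
  | zero =>
    intro k hkn hk _ i
    obtain rfl : k = n := by omega
    have hproj : Projective (ModuleCat.of (CAlg 𝒜 (lowerUnion Z k)) (CAlg 𝒜 (lowerUnion Z k))) :=
      (IsProjective.iff_projective _).1 inferInstance
    have hid : ∀ x, restrictMap 𝒜 (lowerUnion_mono Z hkn) x = x := by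
      intro x
      obtain ⟨x, rfl⟩ := toCAlg_surjective 𝒜 _ x
      rfl
    refine @subsingleton_ext_of_retract _ _ _ (CAlg 𝒜 (lowerUnion Z k)) (CAlg 𝒜 (lowerUnion Z k))
      _ _ _ (restrictModule 𝒜 (lowerUnion_mono Z hkn))
      (@LinearMap.mk _ _ _ _ _ _ _ _ _ (restrictModule 𝒜 (lowerUnion_mono Z hkn)) _
        ⟨id, fun _ _ => rfl⟩ fun x y => congrArg (· * y) (hid x))
      (@LinearMap.mk _ _ _ _ _ _ _ _ _ _ (restrictModule 𝒜 (lowerUnion_mono Z hkn))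
        ⟨id, fun _ _ => rfl⟩ fun x y => congrArg (· * y) (hid x).symm)
      (fun _ => rfl) (i + 1) (Ext.subsingleton_of_projective _ _ _)
  | succ j ih =>
    intro k hkn hk hqk i
    have hstep := ih (k + 1) (by omega) (by omega) (by omega)
    let : Module (CAlg 𝒜 (lowerUnion Z n)) (CAlg 𝒜 (lowerUnion Z (k + 1))) :=
      restrictModule 𝒜 (lowerUnion_mono Z (by omega))
    let : Module (CAlg 𝒜 (lowerUnion Z n)) (CAlg 𝒜 (lowerUnion Z k)) :=
      restrictModule 𝒜 (lowerUnion_mono Z hkn)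
    have : IsScalarTower (CAlg 𝒜 (lowerUnion Z n)) (CAlg 𝒜 (lowerUnion Z (k + 1)))
        (CAlg 𝒜 (lowerUnion Z (k + 1))) := ⟨fun x y z => mul_assoc _ _ _⟩
    have hkm : k < m := by omega
    let : Fintype (stratum Z k) := (h.finite_stratum hkm).fintype
    refine (h.isFactorization (hq.trans_le hqk) hkm).subsingleton_ext_quotient ?_
      (h.idem_eq_sum_stratum hkm) ?_ hstep
      { toFun := restrictMap 𝒜 (lowerUnion_mono Z (Nat.le_succ k))
        map_add' := map_add _
        map_smul' := fun x y => ?_ } (restrictMap_surjective 𝒜 (lowerUnion_mono Z (Nat.le_succ k)))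
      (restrictMap_eq_zero_iff 𝒜 (lowerUnion_mono Z (Nat.le_succ k))) i
    · intro x
      obtain ⟨y, rfl⟩ := restrictMap_surjective 𝒜 (lowerUnion_mono Z (by omega : k + 1 ≤ n)) x
      exact ⟨y, mul_one _⟩
    · intro z
      refine ⟨pointMap 𝒜 _ (z : S) 1, mul_one _, hN _ ?_⟩
      rw [← restrictMap_eq_zero_iff 𝒜 (lowerUnion_mono Z (by omega : q ≤ n))]
      refine pointMap_eq_zero 𝒜 (X := lowerUnion Z q) (SetLike.one_mem_graded 𝒜) ?_
      rw [zero_vadd]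
      exact fun hz => z.2.2 (lowerUnion_mono Z hqk hz)
    · obtain ⟨x, rfl⟩ := toCAlg_surjective 𝒜 _ x
      change restrictMap 𝒜 _ (toCAlg 𝒜 _ x * y) = toCAlg 𝒜 _ x * restrictMap 𝒜 _ y
      rw [map_mul]
      rfl

theorem IsConvexDecomposition.isStrongIdempotent (h : IsConvexDecomposition 𝒜 J d Z) {q n : ℕ}
    (hq : 0 < q) (hqn : q ≤ n) (hnm : n ≤ m) :
    IsStrongIdempotent
      (TwoSidedIdeal.span {CAlg.idem 𝒜 (lowerUnion Z n) (lowerUnion Z q)ᶜ}) := by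
  intro N hN i hi
  obtain ⟨i, rfl⟩ := Nat.exists_eq_add_of_le' hi
  have h₁ := h.subsingleton_ext hq hnm N hN (n - q) q hqn (by omega) le_rfl i
  let : Module (CAlg 𝒜 (lowerUnion Z n)) (CAlg 𝒜 (lowerUnion Z q)) :=
    restrictModule 𝒜 (lowerUnion_mono Z hqn)
  let r : CAlg 𝒜 (lowerUnion Z n) →ₗ[CAlg 𝒜 (lowerUnion Z n)] CAlg 𝒜 (lowerUnion Z q) :=
    { toFun := restrictMap 𝒜 (lowerUnion_mono Z hqn)
      map_add' := map_add _
      map_smul' := fun x y => map_mul (restrictMap 𝒜 (lowerUnion_mono Z hqn)) x y }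
  have hr : Function.Surjective r := restrictMap_surjective 𝒜 (lowerUnion_mono Z hqn)
  have hker : (TwoSidedIdeal.span
      {CAlg.idem 𝒜 (lowerUnion Z n) (lowerUnion Z q)ᶜ}).asIdeal = LinearMap.ker r := by
    ext x
    rw [TwoSidedIdeal.mem_asIdeal]
    exact (restrictMap_eq_zero_iff 𝒜 (lowerUnion_mono Z hqn) x).symm
  let e := (Submodule.quotEquivOfEq _ _ hker).trans (LinearMap.quotKerEquivOfSurjective r hr)
  exact subsingleton_ext_of_retract e.toLinearMap e.symm.toLinearMap e.symm_apply_apply (i + 1) h₁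

end Chain

section Translation

theorem initialUnion_eq_lowerUnion {m : ℕ} {S : Type*} (Z : Fin m → Set S) (j : Fin m) :
    initialUnion Z j = lowerUnion Z (j + 1) := by
  ext y
  unfold initialUnion
  rw [Set.mem_iUnion₂]
  exact ⟨fun ⟨k, hk, hy⟩ => ⟨k, Nat.lt_succ_of_le hk, hy⟩,
    fun ⟨k, hk, hy⟩ => ⟨k, Nat.le_of_lt_succ hk, hy⟩⟩

theorem iUnion_eq_lowerUnion {m : ℕ} {S : Type*} (Z : Fin m → Set S) :
    ⋃ i, Z i = lowerUnion Z m := by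
  ext y
  simp [lowerUnion]

variable {K A Γ S : Type*} [Field K] [Ring A] [Algebra K A] [AddCommMonoid Γ] [DecidableEq Γ]
  [AddAction Γ S] {m : ℕ} {As : Fin m → Submodule K A} {ι : Fin m → Type*}
  {𝒜 : Γ → Submodule K A} [GradedAlgebra 𝒜] {J : ∀ i, Module.Basis (ι i) K (As i)}
  {d : ∀ i, ι i → Γ} {Z : Fin m → Set S}

theorem isGradedSubalgebra_segSub (hAs : ∀ i, IsGradedSubalgebra 𝒜 (As i))
    (hAij : ∀ i j : Fin m, i < j → IsGradedSubalgebra 𝒜 (interval As i j)) (i j : Fin m)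
    (hij : i ≤ j) : IsGradedSubalgebra 𝒜 (segSub As i (j + 1)) := by
  rcases hij.lt_or_eq with hij | rfl
  · rw [← interval_eq_segSub]
    exact hAij i j hij
  · rw [segSub, segment_succ, List.map_singleton, List.prod_singleton]
    exact hAs i

theorem isConvexDecomposition
    (hAs : ∀ i, IsGradedSubalgebra 𝒜 (As i)) (hA : Function.Bijective (prodMap As))
    (hAij : ∀ i j : Fin m, i < j → IsGradedSubalgebra 𝒜 (interval As i j))
    (hJ : ∀ i k, (J i k : A) ∈ 𝒜 (d i k)) (hZ : Pairwise fun i j => Disjoint (Z i) (Z j))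
    (hfin : (lowerUnion Z m).Finite) (hconv : IsGammaConvex Γ (lowerUnion Z m))
    (G : Fin m → AddSubmonoid Γ) (h₁ : ∀ i, ∀ γ ∉ G i, As i ⊓ 𝒜 γ = ⊥)
    (h₂ : ∀ i j : Fin m, i ≤ j →
      ((G j : Set Γ) +ᵥ Z i) ∩ lowerUnion Z m ⊆ ⋃ k ∈ Set.Icc i j, Z k)
    (h₃ : ∀ i j : Fin m, i < j →
      ((G i : Set Γ) +ᵥ initialUnion Z j) ∩ lowerUnion Z m = initialUnion Z j) :
    IsConvexDecomposition 𝒜 J d Z := by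
  have hd : ∀ k i, d k i ∈ G k := by
    intro k i
    by_contra hk
    have h : (J k i : A) ∈ As k ⊓ 𝒜 (d k i) := ⟨(J k i).2, hJ k i⟩
    rw [h₁ k _ hk, Submodule.mem_bot] at h
    exact (J k).ne_zero i (Subtype.ext h)
  refine ⟨hJ, hA, fun k => (hAs k).1.1, fun p hp hpm => ?_, fun p hp hpm => ?_, hfin, hconv,
    fun k i p y hkp hpm hy hY => ?_, fun k i p y hpk hy hy' hmem => ?_⟩
  · have h := isGradedSubalgebra_segSub hAs hAij ⟨0, by omega⟩ ⟨p - 1, by omega⟩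
      (by simp [Fin.le_def])
    simp only [Nat.sub_add_cancel hp] at h
    exact h.1.2
  · have h := isGradedSubalgebra_segSub hAs hAij ⟨p, hpm⟩ ⟨m - 1, by omega⟩
      (by simp only [Fin.le_def]; omega)
    simp only [Nat.sub_add_cancel (show 1 ≤ m by omega)] at h
    exact h.1.2
  · rcases (show (k : ℕ) + 1 ≤ p from hkp).lt_or_eq with hk | rfl
    · have h := h₃ k ⟨p - 1, by omega⟩ (by simp only [Fin.lt_def]; omega)
      rw [initialUnion_eq_lowerUnion] at h
      simp only [Nat.sub_add_cancel (show 1 ≤ p by omega)] at h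
      rw [← h]
      exact ⟨Set.vadd_mem_vadd (hd k i) hy, hY⟩
    · obtain ⟨l, hl, hy⟩ := hy
      have h := h₂ l k (by simp only [Fin.le_def]; omega) ⟨Set.vadd_mem_vadd (hd k i) hy, hY⟩
      simp only [Set.mem_iUnion] at h
      obtain ⟨l', hl', h⟩ := h
      exact ⟨l', Nat.lt_succ_of_le hl'.2, h⟩
  · obtain ⟨l, hl, hy⟩ := hy
    have hlp : p ≤ (l : ℕ) := by
      by_contra hlt
      exact hy' ⟨l, by omega, hy⟩
    have h := h₂ l k (by simp only [Fin.le_def]; omega) ⟨Set.vadd_mem_vadd (hd k i) hy,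
      lowerUnion_mono Z (hpk.trans k.2.le) hmem⟩
    simp only [Set.mem_iUnion] at h
    obtain ⟨l', hl', h⟩ := h
    obtain ⟨l'', hl'', h''⟩ := hmem
    have hne : l' ≠ l'' := by
      rintro rfl
      have := hl'.1
      simp only [Fin.le_def] at this
      omega
    exact Set.disjoint_left.1 (hZ hne) h h''

namespace IsConvexDecomposition

theorem basisIndex_path {Γ S : Type*} [AddCommMonoid Γ] [AddAction Γ S] {m : ℕ}
    {ι : Fin m → Type*} {d : ∀ i, ι i → Γ} {X : Set S} (p : BasisIndex d X) (k : ℕ) (hk : k ≤ m) :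
    segDeg d p.1.1 k m +ᵥ p.1.2 ∈ X := by
  rcases hk.lt_or_eq with hk | rfl
  · have h := p.2.2 ⟨k, hk⟩
    rwa [← segDeg_eq_sum] at h
  · rw [segDeg_self, zero_vadd]
    exact p.2.1

theorem basisElement_eq {X : Set S} (p : BasisIndex d X) :
    basisElement 𝒜 J d X p = pointMap 𝒜 X p.1.2 (segProd J p.1.1 0 m) := by
  rw [basisElement, chi_eq_pointMap, segProd_zero]

theorem basis (h : IsConvexDecomposition 𝒜 J d Z) {q : ℕ} (hq : 0 < q) (hqm : q ≤ m) :
    LinearIndependent K (basisElement 𝒜 J d (lowerUnion Z q)) ∧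
      Submodule.span K (Set.range (basisElement 𝒜 J d (lowerUnion Z q))) = ⊤ := by
  constructor
  · have h₁ := h.linearIndependent_basisElement hq hqm
      (fun p : BasisIndex d (lowerUnion Z q) => p.1) Subtype.val_injective
      fun p k hk => basisIndex_path p k hk
    rw [funext basisElement_eq]
    exact h₁
  · rw [eq_top_iff]
    rintro c -
    refine Submodule.span_mono ?_
      (h.mem_span_basisElement (h.finite.subset (lowerUnion_mono Z hqm)) c)
    rintro _ ⟨f, y, hf, rfl⟩
    refine ⟨⟨(f, y), ?_, fun k => ?_⟩, basisElement_eq _⟩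
    · have h₁ := hf m le_rfl
      rwa [segDeg_self, zero_vadd] at h₁
    · rw [← segDeg_eq_sum]
      exact hf k k.2.le

end IsConvexDecomposition

end Translation

end SkewConvex

end

theorem mainTheorem4 {K A Γ S : Type*} [Field K] [Ring A] [Algebra K A]
    [AddCommMonoid Γ] [DecidableEq Γ] (𝒜 : Γ → Submodule K A) [GradedAlgebra 𝒜] [AddAction Γ S]
    -- `Γ` is positive and acts effectively on `S`
    (hpos : ∀ γ₁ γ₂ : Γ, γ₁ + γ₂ = 0 → γ₁ = 0 ∧ γ₂ = 0)
    (heff : ∀ (x : S) (γ₁ γ₂ : Γ), γ₁ ≠ γ₂ → γ₁ +ᵥ x ≠ γ₂ +ᵥ x)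
    -- `A = A_1 ⊗ ⋯ ⊗ A_m`, and the `A_{ij}` are graded subalgebras
    (m : ℕ) (hm : 1 ≤ m) (As : Fin m → Submodule K A)
    (hAs : ∀ i, SkewConvex.IsGradedSubalgebra 𝒜 (As i))
    (hA : Function.Bijective (SkewConvex.prodMap As))
    (hAij : ∀ i j : Fin m, i < j →
      SkewConvex.IsGradedSubalgebra 𝒜 (SkewConvex.interval As i j))
    -- homogeneous bases `J_i` of the `A_i`, with degrees `d_i`
    {ι : Fin m → Type*} (J : ∀ i, Module.Basis (ι i) K (As i)) (d : ∀ i, ι i → Γ)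
    (hJ : ∀ i k, (J i k : A) ∈ 𝒜 (d i k))
    -- the finite `Γ`-convex set `Y = Z_1 ⊔ ⋯ ⊔ Z_m`
    (Y : Set S) (Z : Fin m → Set S) (hYZ : Y = ⋃ i, Z i)
    (hZ : Pairwise fun i j => Disjoint (Z i) (Z j))
    (hYfin : Y.Finite) (hYconv : SkewConvex.IsGammaConvex Γ Y)
    -- the submonoids `Γ_i` and the compatibility conditions
    (G : Fin m → AddSubmonoid Γ)
    (h₁ : ∀ i, ∀ γ ∉ G i, As i ⊓ 𝒜 γ = ⊥)
    (h₂ : ∀ i j : Fin m, i ≤ j →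
      ((G j : Set Γ) +ᵥ Z i) ∩ Y ⊆ ⋃ k ∈ Set.Icc i j, Z k)
    (h₃ : ∀ i j : Fin m, i < j →
      ((G i : Set Γ) +ᵥ SkewConvex.initialUnion Z j) ∩ Y = SkewConvex.initialUnion Z j) :
    -- the multiplication maps `C(Y_{j+1}) e_j ⊗ e_j C(Y_{j+1}) → C(Y_{j+1}) e_j C(Y_{j+1})`
    (∀ j j' : Fin m, (j : ℕ) + 1 = j' →
      Function.Injective (SkewConvex.cornerMul K (SkewConvex.CAlg.idem 𝒜
          (SkewConvex.initialUnion Z j') (SkewConvex.initialUnion Z j)ᶜ)) ∧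
      Set.range (SkewConvex.cornerMul K (SkewConvex.CAlg.idem 𝒜
          (SkewConvex.initialUnion Z j') (SkewConvex.initialUnion Z j)ᶜ)) =
        (TwoSidedIdeal.span {SkewConvex.CAlg.idem 𝒜
          (SkewConvex.initialUnion Z j') (SkewConvex.initialUnion Z j)ᶜ} : Set _)) ∧
    -- the bases of the algebras `C(Y_j)`
    (∀ j : Fin m,
      LinearIndependent K
        (SkewConvex.basisElement 𝒜 J d (SkewConvex.initialUnion Z j)) ∧
      Submodule.span K
        (Set.range (SkewConvex.basisElement 𝒜 J d (SkewConvex.initialUnion Z j))) = ⊤) ∧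
    -- the strong idempotent ideals
    (Ring.jacobson (𝒜 0) = ⊥ →
      (∀ j : Fin m, 0 < (j : ℕ) → ∃ o : PartialOrder (Z j),
        (∀ i, j ≤ i → ∀ z z' : Z j, SkewConvex.leBy (G i) (z : S) z' → o.le z z') ∧
        (∀ i, i < j → ∀ z z' : Z j, SkewConvex.leBy (G i) (z : S) z' → o.le z' z)) →
      (∀ j j' : Fin m, (j : ℕ) + 1 = j' →
        SkewConvex.IsStrongIdempotent (TwoSidedIdeal.span
          {SkewConvex.CAlg.idem 𝒜 (SkewConvex.initialUnion Z j')
            (SkewConvex.initialUnion Z j)ᶜ})) ∧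
      SkewConvex.IsStrongIdempotent (TwoSidedIdeal.span
        {SkewConvex.CAlg.idem 𝒜 Y (Z ⟨0, hm⟩)ᶜ})) := by
  subst hYZ
  rw [SkewConvex.iUnion_eq_lowerUnion] at hYfin hYconv h₂ h₃ ⊢
  have h : SkewConvex.IsConvexDecomposition 𝒜 J d Z :=
    SkewConvex.isConvexDecomposition hAs hA hAij hJ hZ hYfin hYconv G h₁ h₂ h₃
  refine ⟨fun j j' hj => ?_, fun j => ?_, fun _ _ => ⟨fun j j' hj => ?_, ?_⟩⟩
  · rw [SkewConvex.initialUnion_eq_lowerUnion, SkewConvex.initialUnion_eq_lowerUnion, hj]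
    have hm' : (j' : ℕ) < m := j'.2
    let : Fintype (SkewConvex.stratum Z j') := (h.finite_stratum hm').fintype
    have hf := h.isFactorization (p := j') (by omega) hm'
    have he := h.idem_eq_sum_stratum hm'
    exact ⟨hf.injective_cornerMul he, SkewConvex.range_cornerMul K (hf.sum_mul_sum he)⟩
  · rw [SkewConvex.initialUnion_eq_lowerUnion]
    exact h.basis (Nat.succ_pos _) j.2
  · rw [SkewConvex.initialUnion_eq_lowerUnion, SkewConvex.initialUnion_eq_lowerUnion]
    exact h.isStrongIdempotent (Nat.succ_pos _) (by omega) j'.2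
  · have hZ₀ : Z ⟨0, hm⟩ = SkewConvex.lowerUnion Z 1 := by
      ext y
      refine ⟨fun hy => ⟨_, Nat.one_pos, hy⟩, fun ⟨k, hk, hy⟩ => ?_⟩
      rwa [show k = ⟨0, hm⟩ from Fin.ext (Nat.lt_one_iff.1 hk)] at hy
    rw [hZ₀]
    exact h.isStrongIdempotent Nat.one_pos hm le_rfl
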